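/- Let $n\ge 0$, let $U\subset\mathbb C^n$ be open, and let $V=\sum_{i=1}^n g_i(z)\,\frac{\partial}{\partial \xi_i}$ be an odd holomorphic vector field on the superdomain of dimension $n|n$ with body $U$, with even coordinates $z_1,\dots,z_n$ and odd coordinates $\xi_1,\dots,\xi_n$; here $g_1,\dots,g_n$ are holomorphic functions on $U$ (even, without odd variables). Let $p\in U$ be a non-degenerate zero of $V$, i.e. $g_1(p)=\dots=g_n(p)=0$ and $\det(JV)(p)\neq 0$ with $JV=\left(\frac{\partial g_i}{\partial z_j}\right)_{n\times n}$. Let $\varepsilon>0$ be such that the closed Euclidean ball $\overline{B}_\varepsilon(p)$ lies in $U$ and contains no zero of $V$ other than $p$. *Superforms.* A superform $\eta\in\bigoplus A^{(p,q)|(r,s)}$ is a sum of monomials in $dz_j,d\bar z_j,d\xi_j,d\bar\xi_j,\xi_j,\bar\xi_j$ with smooth coefficient functions of $z$ on $U$, written on the right, with values in the Grassmann constants $\mathbb C_S$. The differentials have degree $1$ and $\xi_j,\bar\xi_j$ have degree $0$; $dz_j,d\bar z_j$ are even and $d\xi_j,d\bar\xi_j,\xi_j,\bar\xi_j$ are odd;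 generators $a,b$ commute up to the sign $(-1)^{\deg a\deg b+|a||b|}$ (so the $d\xi_j,d\bar\xi_j$ commute with each other), and coefficient functions do not contribute to signs. Put $\bar\partial=\sum_j d\bar z_j\wedge\frac{\partial}{\partial\bar z_j}+\sum_j d\bar\xi_j\wedge\frac{\partial}{\partial\bar\xi_j}$ (with $\frac{\partial}{\partial\bar\xi_j}$ the graded left derivation that kills the other generators), and let $i_V$ be the graded contraction: $i_V(d\xi_j)=g_j$, $i_V=0$ on functions and on the other differentials, and $i_V(\alpha\wedge\beta)=i_V(\alpha)\wedge\beta+(-1)^{\deg\alpha+|\alpha|}\alpha\wedge i_V(\beta)$. The integral of a superform over the superball $SB_\varepsilon(p)$ with body $B_\varepsilon(p)$ is $$\int_{SB_\varepsilon(p)}\Theta=\int_{B_\varepsilon(p)}dz_1\wedge\dots\wedge dz_n\wedge d\bar z_1\wedge\dots\wedge d\bar z_n\; f,$$ where $f(z)$ is the coefficient of $dz_1\cdots dz_n\,d\bar z_1\cdots d\bar z_n\,d\xi_1\cdots d\xi_n\,d\bar\xi_1\cdots d\bar\xi_n\;\xi_1\cdots\xi_n\bar\xi_1\cdots\bar\xi_n$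 in $\Theta$ (Berezin integral). *Residue.* Let $\omega=\sum_j dz_j\,\bar g_j+\sum_j d\xi_j\,\bar g_j$ and $$\mathrm{Res}_p(V,\eta)=\lim_{t\to0^+}\int_{SB_\varepsilon(p)}\eta\wedge\exp\left\{-\frac{\bar\partial\omega}{t}-\frac{i_V(\omega)}{t}\right\}.$$ Then for every such superform $\eta$ (in particular whenever $(\bar\partial+i_V)\eta=0$), with no condition on the parity of $n$ or of the coefficients of $\eta$, the integrals converge for all $t>0$, the limit exists, and $$\mathrm{Res}_p(V,\eta)=\left(\frac{2\pi}{i}\right)^n\left[\frac{\eta^{(0,0)|(n,n)}_{(1\dots n;1\dots n)}+\eta^{(1,0)|(n-1,n)}_{\ \widehat *\,(1\dots n;1\dots n)}}{\det(JV)}\right](p).$$ Here $\eta^{(0,0)|(n,n)}_{(1\dots n;1\dots n)}$ is the coefficient function of $d\xi_1\cdots d\xi_n\,d\bar\xi_1\cdots d\bar\xi_n\;\xi_1\cdots\xi_n\bar\xi_1\cdots\bar\xi_n$ in $\eta$, and $\eta^{(1,0)|(n-1,n)}_{\ \widehat *\,(1\dots n;1\dots n)}$ is the sum over $j=1,\dots,n$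 of the coefficient functions of $dz_j\,d\xi_1\cdots\widehat{d\xi_j}\cdots d\xi_n\,d\bar\xi_1\cdots d\bar\xi_n\;\xi_1\cdots\xi_n\bar\xi_1\cdots\bar\xi_n$. -/

import Mathlib

open Filter Topology MeasureTheory
open scoped ContDiff

namespace SuperResidue

noncomputable section

/-- The Grassmann constants `ℂ_S` with generators `β_0, β_1, …`: the element `X` is the formal sum
`∑_l X l • β_[l]` over finite multi-indices `l`. The coefficient functions of superforms take values
in it; only its structure of a complex vector space and its coordinates are used. -/
abbrev GrassmannC : Type := Finset ℕ → ℂ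

/-- The generators of the algebra of superforms on the superspace of dimension `n|n`, in the order
`dz_j < dz̄_j < dξ_j < dξ̄_j < ξ_j < ξ̄_j`, each block being ordered by `j`. -/
abbrev Gen (n : ℕ) : Type := Fin 6 ×ₗ Fin n

variable {n : ℕ}

/-- The generator `dz_j`. -/
def dz (j : Fin n) : Gen n := toLex (0, j)
/-- The generator `dz̄_j`. -/
def dzBar (j : Fin n) : Gen n := toLex (1, j)
/-- The generator `dξ_j`. -/
def dxi (j : Fin n) : Gen n := toLex (2, j)
/-- The generator `dξ̄_j`. -/
def dxiBar (j : Fin n) : Gen n := toLex (3, j)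
/-- The generator `ξ_j`. -/
def xi (j : Fin n) : Gen n := toLex (4, j)
/-- The generator `ξ̄_j`. -/
def xiBar (j : Fin n) : Gen n := toLex (5, j)

/-- The degree as a differential form: `1` for `dz, dz̄, dξ, dξ̄` and `0` for `ξ, ξ̄`. -/
def formDegree (k : Gen n) : ℕ := if (ofLex k).1 < 4 then 1 else 0

/-- The parity: `0` for `dz, dz̄` and `1` for `dξ, dξ̄, ξ, ξ̄`. -/
def parity (k : Gen n) : ℕ := if (ofLex k).1 < 2 then 0 else 1

/-- The sign `ε` in the commutation rule `k ∧ l = ε • l ∧ k` of two generators. -/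
def commSign (k l : Gen n) : ℤ := (-1) ^ (formDegree k * formDegree l + parity k * parity l)

/-- An exponent vector `a` names the monomial `∏_k k ^ (a k)`, the generators written in increasing
order. It is admissible when the generators that anticommute with themselves (`dz, dz̄, ξ, ξ̄`) occur
at most once; the commuting differentials `dξ, dξ̄` may occur with any power. -/
def IsMonomial (a : Gen n → ℕ) : Prop := ∀ k, commSign k k = -1 → a k ≤ 1

/-- Superforms: (formal) sums `∑_a x^a • Φ a (z)` over the admissible monomials, the coefficient
functions of the even variables being written on the right. With `M = ℂ` the constants are complex
numbers, with `M = GrassmannC` they are Grassmann constants. -/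
abbrev Superform (n : ℕ) (M : Type) : Type :=
  {a : Gen n → ℕ // IsMonomial a} → (Fin n → ℂ) → M

section

variable {M : Type} [AddCommGroup M] [Module ℂ M]

open Classical in
/-- The coefficient function of the monomial with exponents `a` (zero if there is none). -/
def coeff (Φ : Superform n M) (a : Gen n → ℕ) : (Fin n → ℂ) → M :=
  if h : IsMonomial a then Φ ⟨a, h⟩ else 0

/-- The sign that arises when the product `x^a ∧ x^b` is put in increasing order: each generator `k`
of `x^a` passes each generator `l < k` of `x^b`. -/
def mulSign (a b : Gen n → ℕ) : ℤ :=
  ∏ k, ∏ l, if l < k then commSign k l ^ (a k * b l) else 1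

/-- The product of superforms,
`(∑ x^a Φ_a) ∧ (∑ x^b Ψ_b) = ∑ mulSign a b • x^(a+b) Φ_a Ψ_b`. -/
def wedge (Φ : Superform n M) (Ψ : Superform n ℂ) : Superform n M := fun c z =>
  ∑ a ∈ Finset.Iic c.1, mulSign a (c.1 - a) • (coeff Ψ (c.1 - a) z • coeff Φ a z)

end

open Classical in
/-- A function of the even variables as a superform of degree zero. -/
def ofFun (f : (Fin n → ℂ) → ℂ) : Superform n ℂ := fun a z => if a.1 = 0 then f z else 0

open Classical in
/-- A generator as a superform. -/
def ofGen (k : Gen n) : Superform n ℂ := fun a _ => if a.1 = Pi.single k 1 then 1 else 0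

/-- Powers of a superform. -/
def wedgePow (Φ : Superform n ℂ) : ℕ → Superform n ℂ
  | 0 => ofFun fun _ => 1
  | m + 1 => wedge (wedgePow Φ m) Φ

/-- The exponential series `∑_m Φ^m / m!`, summed coefficientwise. -/
def expForm (Φ : Superform n ℂ) : Superform n ℂ := fun a z =>
  ∑' m : ℕ, ((m.factorial : ℂ))⁻¹ * wedgePow Φ m a z

/-- The graded left derivation with respect to the generator `k`: it sends `k` to `1`, the other
generators and the functions of the even variables to `0`, and passes a generator `l` with the sign
`commSign k l`. -/
def leftDeriv (k : Gen n) (Φ : Superform n ℂ) : Superform n ℂ := fun c z =>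
  (∏ l, if l < k then (commSign k l : ℂ) ^ c.1 l else 1) * (c.1 k + 1 : ℂ) *
    coeff Φ (c.1 + Pi.single k 1) z

/-- The Wirtinger derivative `∂f/∂z̄_j = (∂f/∂x_j + i ∂f/∂y_j) / 2`. -/
def wirtingerBar (j : Fin n) (f : (Fin n → ℂ) → ℂ) (z : Fin n → ℂ) : ℂ :=
  (fderiv ℝ f z (Pi.single j 1) + Complex.I * fderiv ℝ f z (Pi.single j Complex.I)) / 2

/-- The operator `∂̄ = ∑_j dz̄_j ∧ ∂/∂z̄_j + ∑_j dξ̄_j ∧ ∂/∂ξ̄_j`; on `dX f` with `dX` a product of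
differentials of degree `p` it is `(-1)^p dX ∧ ∂̄f`. -/
def dbar (Φ : Superform n ℂ) : Superform n ℂ :=
  ∑ j, wedge (ofGen (dzBar j)) (fun a => wirtingerBar j (Φ a)) +
  ∑ j, wedge (ofGen (dxiBar j)) (leftDeriv (xiBar j) Φ)

/-- The contraction with the odd vector field `V = ∑_j g_j(z) ∂/∂ξ_j`: the graded derivation with
`i_V(dξ_j) = g_j` that kills functions and the other differentials, so that
`i_V(α ∧ β) = i_V(α) ∧ β + (-1)^k (-1)^(parity α) α ∧ i_V(β)` for `α` of degree `k`. -/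
def contract (g : Fin n → (Fin n → ℂ) → ℂ) (Φ : Superform n ℂ) : Superform n ℂ :=
  ∑ j, wedge (ofFun (g j)) (leftDeriv (dxi j) Φ)

/-- The local form `ω = ∑_j dz_j ḡ_j + ∑_j dξ_j ḡ_j` attached to `V = ∑_j g_j(z) ∂/∂ξ_j`. -/
def omega (g : Fin n → (Fin n → ℂ) → ℂ) : Superform n ℂ :=
  ∑ j, wedge (ofGen (dz j)) (ofFun fun z => starRingEnd ℂ (g j z)) +
  ∑ j, wedge (ofGen (dxi j)) (ofFun fun z => starRingEnd ℂ (g j z))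

/-- The form `exp(-∂̄ω/t - i_V(ω)/t)`. -/
def localizer (g : Fin n → (Fin n → ℂ) → ℂ) (t : ℝ) : Superform n ℂ :=
  expForm (-((t : ℂ)⁻¹ • dbar (omega g)) - (t : ℂ)⁻¹ • contract g (omega g))

/-- The exponents of the monomial in which every generator occurs exactly once. -/
def topMonomial : Gen n → ℕ := fun _ => 1

/-- The exponents of
`dξ_1 ∧ ⋯ ∧ dξ_n ∧ dξ̄_1 ∧ ⋯ ∧ dξ̄_n ξ_1 ⋯ ξ_n ξ̄_1 ⋯ ξ̄_n`. -/
def fermiMonomial : Gen n → ℕ := fun k => if (ofLex k).1 < 2 then 0 else 1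

/-- The exponents of
`dz_j ∧ dξ_1 ∧ ⋯ (no dξ_j) ⋯ ∧ dξ_n ∧ dξ̄_1 ∧ ⋯ ∧ dξ̄_n ξ_1 ⋯ ξ_n ξ̄_1 ⋯ ξ̄_n`. -/
def mixedMonomial (j : Fin n) : Gen n → ℕ := fun k =>
  if k = dz j then 1 else if k = dxi j then 0 else fermiMonomial k

/-- The body of the superball with centre `p` and radius `ε`: a Euclidean ball of `ℂ^n`. The
superball itself consists of all points whose body lies in it. -/
def bodyBall (p : Fin n → ℂ) (ε : ℝ) : Set (Fin n → ℂ) := {z | ∑ j, ‖z j - p j‖ ^ 2 < ε ^ 2}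

/-- The closed Euclidean ball of `ℂ^n`. -/
def closedBodyBall (p : Fin n → ℂ) (ε : ℝ) : Set (Fin n → ℂ) :=
  {z | ∑ j, ‖z j - p j‖ ^ 2 ≤ ε ^ 2}

/-- The integral of a superform over the superdomain with body `B`: the Berezin integral selects the
coefficient `f` of the monomial in which every generator occurs once, and
`dz_1 ∧ ⋯ ∧ dz_n ∧ dz̄_1 ∧ ⋯ ∧ dz̄_n f` is integrated over `B`, where
`dz_1 ∧ ⋯ ∧ dz_n ∧ dz̄_1 ∧ ⋯ ∧ dz̄_n = (-1)^(n(n-1)/2) (-2i)^n dx_1 ∧ dy_1 ∧ ⋯ ∧ dx_n ∧ dy_n`.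
A function with values in the Grassmann constants is integrated coordinatewise. -/
def superIntegral (B : Set (Fin n → ℂ)) (Θ : Superform n GrassmannC) : GrassmannC := fun l =>
  (-1) ^ (n * (n - 1) / 2) * (-2 * Complex.I) ^ n * ∫ z in B, coeff Θ topMonomial z l

/-- `Res_p(V, η) = c`, computed on the superball of radius `ε`: for every `t > 0` the integral of
`η ∧ exp(-∂̄ω/t - i_V(ω)/t)` over the superball converges, and it tends to `c` as `t → 0⁺`. -/
def HasResidue (g : Fin n → (Fin n → ℂ) → ℂ) (η : Superform n GrassmannC) (p : Fin n → ℂ) (ε : ℝ)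
    (c : GrassmannC) : Prop :=
  (∀ t : ℝ, 0 < t → ∀ l : Finset ℕ,
    IntegrableOn (fun z => coeff (wedge η (localizer g t)) topMonomial z l) (bodyBall p ε)) ∧
  Tendsto (fun t : ℝ => superIntegral (bodyBall p ε) (wedge η (localizer g t))) (𝓝[>] 0) (𝓝 c)

/-- A superform is smooth over `U` when all coefficient functions are smooth there. -/
def SmoothOn (η : Superform n GrassmannC) (U : Set (Fin n → ℂ)) : Prop :=
  ∀ a l, ContDiffOn ℝ ∞ (fun z => η a z l) U

/-- The matrix `JV = (∂g_i/∂z_j)` at `p`. -/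
def jacobian (g : Fin n → (Fin n → ℂ) → ℂ) (p : Fin n → ℂ) : Matrix (Fin n) (Fin n) ℂ :=
  Matrix.of fun i j => fderiv ℂ (g i) p (Pi.single j 1)

end

end SuperResidue

/-! The localizing form is graded by the number of factors `dz̄`. Since `g` is holomorphic and `ω`
contains no `ξ̄`, `-∂̄ω` equals `Q = ∑_k (∑_i conj(∂g_i/∂z_k) (dz_i + dξ_i)) ∧ dz̄_k`, and `i_V ω`
is the function `|g|² = ∑ |g_j|²`. Hence the form is `e^{-|g|²/t} ∑_m t^{-m} Q^m / m!`, where `Q^m`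
contains only monomials with `m` factors `dz̄` (`coeff_localizer`).

The Berezin integral is therefore a finite sum of terms `t^{-m} ∫ e^{-|g|²/t} φ` with `m ≤ n`. Near
the non-degenerate zero `|g|²` looks like `|J w|²`, so Laplace's method (`tendsto_laplace`) gives
`t^{-n} ∫ e^{-|g|²/t} φ → π^n |det J|^{-2} φ(p)`. Terms with `m < n` carry an extra power of `t` and
die; only `Q^n / n!` at `p` survives.

The power `Q^n` is computed in `sum_smul_add_mul_pow`. Its part quadratic in the `dξ` vanishes,
because the `dξ` commute while the `dz̄` anticommute; what remains is the pure `dz` product and the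
products with one `dz_j` replaced by `dξ_j`, all with the factor `n! (-1)^{n(n-1)/2} conj(det J)`.
These pair with the two kinds of coefficients of `η` in the formula. The sign from sorting each
exchanged product cancels the sign from multiplying it with its complement
(`sum_mulSign_mul_expCoeff`), so all terms enter with sign `+`. The two factors `(-1)^{n(n-1)/2}`
cancel, and `(-2i)^n π^n conj(det J) / |det J|²` is the stated constant.

Associativity of the product of forms is never needed: powers of a form are powers of its right
multiplication operator, acting on coefficients at one point, so the algebra takes place in an
endomorphism ring. -/

namespace SuperResidue
-- Top powers of quadratic expressions in anticommuting elements.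
section Grassmann

variable {A : Type*} [Ring A] [Algebra ℂ A]

theorem sum_smul_mul_self_eq_zero {n : ℕ} {D : Fin n → A}
    (hD : ∀ i j, D i * D j = -(D j * D i)) (v : Fin n → ℂ) :
    (∑ i, v i • D i) * (∑ i, v i • D i) = 0 := by
  have key : (∑ i, v i • D i) * (∑ i, v i • D i) = -((∑ i, v i • D i) * (∑ i, v i • D i)) := by
    conv_lhs => rw [Finset.sum_mul_sum, Finset.sum_comm]
    rw [Finset.sum_mul_sum, ← Finset.sum_neg_distrib]
    refine Finset.sum_congr rfl fun i _ => ?_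
    rw [← Finset.sum_neg_distrib]
    refine Finset.sum_congr rfl fun j _ => ?_
    rw [smul_mul_smul_comm, smul_mul_smul_comm, hD j i, smul_neg, mul_comm]
  have h2 : (2 : ℂ) • ((∑ i, v i • D i) * (∑ i, v i • D i)) = 0 := by
    rw [two_smul]
    nth_rewrite 1 [key]
    exact neg_add_cancel _
  exact (smul_eq_zero_iff_right (two_ne_zero)).1 h2

/-- An alternating map is determined by its values on injective families of basis vectors. These are
permutations of the basis, and there both sides pick up the sign of the permutation. -/
theorem alternatingMap_eq_det_smul {n : ℕ} {N : Type*} [AddCommGroup N] [Module ℂ N]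
    (f : (Fin n → ℂ) [⋀^Fin n]→ₗ[ℂ] N) (v : Fin n → Fin n → ℂ) :
    f v = (Matrix.of v).det • f (fun i => Pi.single i 1) := by
  have : f = (LinearMap.toSpanSingleton ℂ N (f fun i => Pi.single i 1)).compAlternatingMap
      Matrix.detRowAlternating := by
    refine Module.Basis.ext_alternating (Pi.basisFun ℂ (Fin n)) fun σ hσ => ?_
    obtain ⟨τ, rfl⟩ : ∃ τ : Equiv.Perm (Fin n), σ = τ :=
      ⟨Equiv.ofBijective σ (Finite.injective_iff_bijective.1 hσ), rfl⟩
    have h1 := f.map_perm (fun i => (Pi.basisFun ℂ (Fin n)) i) τ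
    have h2 := (Matrix.detRowAlternating (R := ℂ) (n := Fin n)).map_perm
      (fun i => (Pi.basisFun ℂ (Fin n)) i) τ
    simp only [Function.comp_def] at h1 h2
    rw [LinearMap.compAlternatingMap_apply, h1, h2]
    have h3 : (Matrix.detRowAlternating (R := ℂ) (n := Fin n))
        (fun i => (Pi.basisFun ℂ (Fin n)) i) = 1 := by
      have : (fun i => (Pi.basisFun ℂ (Fin n)) i) = (1 : Matrix (Fin n) (Fin n) ℂ) := by
        ext i j
        simp [Matrix.one_apply, Pi.single_apply, eq_comm]
      rw [this]
      exact Matrix.det_one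
    rw [h3]
    simp only [Pi.basisFun_apply, LinearMap.toSpanSingleton_apply, Units.smul_def, smul_assoc,
      one_smul]
  conv_lhs => rw [this]
  rfl

/-- The product of linear combinations of pairwise anticommuting elements is a determinant. -/
theorem prod_ofFn_sum_smul {n : ℕ} {D : Fin n → A} (hD : ∀ i j, D i * D j = -(D j * D i))
    (M : Matrix (Fin n) (Fin n) ℂ) :
    (List.ofFn fun k => ∑ i, M i k • D i).prod = M.det • (List.ofFn D).prod := by
  let L : (Fin n → ℂ) →ₗ[ℂ] A := ∑ i, (LinearMap.proj i).smulRight (D i)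
  have hL : ∀ v, L v = ∑ i, v i • D i := fun v => by simp [L]
  -- Linear combinations of the `D i` square to zero, so `L` extends to the exterior algebra and the
  -- product becomes an alternating map of the coefficient vectors.
  let φ := ExteriorAlgebra.lift ℂ
    ⟨L, fun v => by rw [hL]; exact sum_smul_mul_self_eq_zero hD v⟩
  have hφ : ∀ v : Fin n → Fin n → ℂ, φ (ExteriorAlgebra.ιMulti ℂ n v) =
      (List.ofFn fun k => ∑ i, v k i • D i).prod := fun v => by
    rw [ExteriorAlgebra.ιMulti_apply, map_list_prod, List.map_ofFn]
    simp [Function.comp_def, φ, hL]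
  have h := alternatingMap_eq_det_smul
    (φ.toLinearMap.compAlternatingMap (ExteriorAlgebra.ιMulti ℂ n)) (fun k i => M i k)
  simp only [LinearMap.compAlternatingMap_apply, AlgHom.toLinearMap_apply, hφ] at h
  rw [h]
  -- The coefficient vectors are the columns of `M`, hence the transpose.
  have : (Matrix.of fun k i => M i k).det = M.det := M.det_transpose
  rw [this]
  simp [Pi.single_apply]

theorem add_pow_succ_of_mul_self_eq_zero {A : Type*} [Ring A] {a S : A} (hcS : Commute a S)
    (hs : a * a = 0) (m : ℕ) :
    (a + S) ^ (m + 1) = S ^ (m + 1) + (m + 1 : ℕ) * (a * S ^ m) := by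
  induction m with
  | zero => simp [add_comm]
  | succ m ih =>
    rw [pow_succ, ih, add_mul, mul_add, mul_add, ← pow_succ]
    have e1 : S ^ (m + 1) * a = a * S ^ (m + 1) := (hcS.pow_right _).eq.symm
    have e2 : ((m + 1 : ℕ) : A) * (a * S ^ m) * a = 0 := by
      rw [mul_assoc, mul_assoc, ← (hcS.pow_right m).eq, ← mul_assoc a, hs, zero_mul, mul_zero]
    rw [e1, e2, mul_assoc, mul_assoc, ← pow_succ]
    push_cast
    noncomm_ring

/-- In the multinomial expansion only squarefree products survive. The vanishing of the next power
is carried along because the induction step for the first claim uses it. -/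
theorem sum_pow_of_mul_self_eq_zero {A : Type*} [Ring A] : ∀ {n : ℕ} {a : Fin n → A},
    (∀ i j, Commute (a i) (a j)) → (∀ i, a i * a i = 0) →
    (∑ i, a i) ^ n = (n.factorial : A) * (List.ofFn a).prod ∧ (∑ i, a i) ^ (n + 1) = 0
  | 0, a, _, _ => by simp
  | n + 1, a, hc, hs => by
    obtain ⟨h1, h2⟩ := sum_pow_of_mul_self_eq_zero (a := fun i => a i.succ)
      (fun i j => hc _ _) (fun i => hs _)
    rw [Fin.sum_univ_succ]
    set S := ∑ i : Fin n, a i.succ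
    have hcS : Commute (a 0) S := Commute.sum_right _ _ _ fun i _ => hc _ _
    have key := add_pow_succ_of_mul_self_eq_zero hcS (hs 0)
    constructor
    · rw [key, h2, zero_add, h1, List.ofFn_succ, List.prod_cons, Nat.factorial_succ]
      push_cast
      have : a 0 * ((n.factorial : A) * (List.ofFn fun i => a i.succ).prod) =
        (n.factorial : A) * (a 0 * (List.ofFn fun i => a i.succ).prod) := by
        rw [← mul_assoc, ← mul_assoc, (Nat.cast_commute _ _).eq]
      rw [this, mul_assoc]
    · rw [key, pow_succ, h2, zero_mul, zero_add, mul_zero, mul_zero]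

theorem prod_ofFn_mul_anticomm {A : Type*} [Ring A] : ∀ {m n : ℕ} {T : Fin n → A} {z : A}
    (_ : ∀ i, T i * z = -(z * T i)) (_ : m = n), (-1) ^ m * (z * (List.ofFn T).prod) =
      (List.ofFn T).prod * z
  | m, 0, T, z, _, h => by subst h; simp
  | m, n + 1, T, z, hz, h => by
    subst h
    have ih := prod_ofFn_mul_anticomm (T := fun i => T i.succ) (fun i => hz i.succ) rfl
    rw [List.ofFn_succ, List.prod_cons, mul_assoc, ← ih, pow_succ]
    have e : ∀ x : A, T 0 * ((-1) ^ n * x) = (-1) ^ n * (T 0 * x) := fun x => by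
      rw [← mul_assoc, ← mul_assoc, ((Commute.neg_one_right (T 0)).pow_right n).eq]
    rw [e, ← mul_assoc (T 0), hz]
    noncomm_ring

theorem prod_ofFn_mul_mul {A : Type*} [Ring A] : ∀ {n : ℕ} {T Z : Fin n → A}
    (_ : ∀ i k, T i * Z k = -(Z k * T i)),
    (List.ofFn fun k => T k * Z k).prod =
      (-1) ^ (n * (n - 1) / 2) * ((List.ofFn T).prod * (List.ofFn Z).prod)
  | 0, T, Z, _ => by simp
  | n + 1, T, Z, h => by
    have ih := prod_ofFn_mul_mul (T := fun i => T i.succ) (Z := fun i => Z i.succ)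
      (fun i k => h _ _)
    have h0 := prod_ofFn_mul_anticomm (T := fun i => T i.succ) (z := Z 0) (fun i => h _ _) rfl
    simp only [List.ofFn_succ, List.prod_cons]
    rw [ih]
    -- Moving `Z 0` past the `n` remaining `T`s costs `(-1)^n`; the total exponent is `0 + 1 + ⋯ +
    -- n`.
    have e : (n + 1) * (n + 1 - 1) / 2 = n * (n - 1) / 2 + n := by
      have := Finset.sum_range_id (n + 1)
      rw [Finset.sum_range_succ, Finset.sum_range_id] at this
      exact this.symm
    rw [e, pow_add]
    have c : ∀ (m : ℕ) (x y : A), x * ((-1) ^ m * y) = (-1) ^ m * (x * y) := fun m x y => by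
      rw [← mul_assoc, ← mul_assoc, ((Commute.neg_one_right x).pow_right m).eq]
    set P := (List.ofFn fun i => T i.succ).prod
    set R := (List.ofFn fun i => Z i.succ).prod
    have e2 : T 0 * P * (Z 0 * R) = (-1) ^ n * (T 0 * Z 0 * (P * R)) := by
      rw [mul_assoc, ← mul_assoc P, ← h0, mul_assoc, mul_assoc, c, mul_assoc]
    have e3 : (-1 : A) ^ n * (-1) ^ n = 1 := by
      rw [← pow_add, ← two_mul, pow_mul]; simp
    rw [e2, mul_assoc ((-1 : A) ^ (n * (n - 1) / 2)), ← mul_assoc ((-1 : A) ^ n), e3, one_mul, c]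

theorem sum_mul_pow {A : Type*} [Ring A] {n : ℕ} {T Z : Fin n → A}
    (hT : ∀ i k, T i * T k = -(T k * T i)) (hT0 : ∀ i, T i * T i = 0)
    (hZ : ∀ i k, Z i * Z k = -(Z k * Z i))
    (hTZ : ∀ i k, T i * Z k = -(Z k * T i)) :
    (∑ k, T k * Z k) ^ n = (n.factorial : A) *
      ((-1) ^ (n * (n - 1) / 2) * ((List.ofFn T).prod * (List.ofFn Z).prod)) := by
  rw [← prod_ofFn_mul_mul hTZ]
  have hZT : ∀ k i, Z k * T i = -(T i * Z k) := fun k i => by rw [hTZ, neg_neg]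
  have e : ∀ i j, T i * Z i * (T j * Z j) = -(T i * T j * (Z i * Z j)) := fun i j => by
    rw [mul_assoc, ← mul_assoc (Z i), hZT]
    noncomm_ring
  refine (sum_pow_of_mul_self_eq_zero (fun i j => ?_) fun i => ?_).1
  · rw [commute_iff_eq, e, e, hT i j, hZ i j]
    noncomm_ring
  · rw [e, hT0, zero_mul, neg_zero]

/-- This is the product rule: over the dual numbers the infinitesimal part of a product replaces one
factor at a time. -/
theorem prod_ofFn_inl_add_inr {A : Type*} [Ring A] : ∀ {n : ℕ} (D X : Fin n → A),
    (List.ofFn fun i => (TrivSqZeroExt.inl (D i) + TrivSqZeroExt.inr (X i) : DualNumber A)).prod =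
      TrivSqZeroExt.inl (List.ofFn D).prod +
        TrivSqZeroExt.inr (∑ j, (List.ofFn (Function.update D j (X j))).prod)
  | 0, D, X => by ext <;> simp
  | n + 1, D, X => by
    rw [List.ofFn_succ, List.prod_cons, prod_ofFn_inl_add_inr]
    have h : ∀ j : Fin n, (List.ofFn (Function.update D j.succ (X j.succ))).prod =
        D 0 * (List.ofFn (Function.update (fun i => D i.succ) j (X j.succ))).prod := fun j => by
      rw [List.ofFn_succ, List.prod_cons]
      have hu : (fun i : Fin n => Function.update D j.succ (X j.succ) i.succ) =
          Function.update (fun i => D i.succ) j (X j.succ) := by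
        funext i
        simp [Function.update_apply]
      rw [hu, Function.update_of_ne (Fin.succ_ne_zero j).symm]
    have h0 : (List.ofFn (Function.update D 0 (X 0))).prod =
        X 0 * (List.ofFn fun i => D i.succ).prod := by
      simp [List.ofFn_succ]
    rw [Fin.sum_univ_succ, h0]
    simp only [h]
    ext
    · simp [List.ofFn_succ]
    · simp [Finset.mul_sum, add_comm]

/-- The top power of `∑_k (∑_i M_ik (D_i + X_i)) Z_k`, where the `D_i, Z_k` anticommute and the
`X_i` commute with each other and anticommute with the `D_i` and `Z_k`. -/
theorem sum_smul_add_mul_pow {n : ℕ} {D X Z : Fin n → A}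
    (hD : ∀ i k, D i * D k = -(D k * D i)) (hZ : ∀ i k, Z i * Z k = -(Z k * Z i))
    (hX : ∀ i k, X i * X k = X k * X i) (hDX : ∀ i k, D i * X k = -(X k * D i))
    (hDZ : ∀ i k, D i * Z k = -(Z k * D i)) (hXZ : ∀ i k, X i * Z k = -(Z k * X i))
    (M : Matrix (Fin n) (Fin n) ℂ) :
    (∑ k, (∑ i, M i k • (D i + X i)) * Z k) ^ n =
      ((n.factorial : ℂ) * (-1) ^ (n * (n - 1) / 2) * M.det) •
        (((List.ofFn D).prod + ∑ j, (List.ofFn (Function.update D j (X j))).prod) *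
          (List.ofFn Z).prod) := by
  have hZX : ∀ k i, Z k * X i = -(X i * Z k) := fun k i => by rw [hXZ, neg_neg]
  have hZD : ∀ k i, Z k * D i = -(D i * Z k) := fun k i => by rw [hDZ, neg_neg]
  set E : Fin n → A := fun k => ∑ i, M i k • D i with hE
  set Y : Fin n → A := fun k => ∑ i, M i k • X i with hY
  have hYY : ∀ k l, Y k * Y l = Y l * Y k := fun k l => by
    refine (Commute.sum_left _ _ _ fun i _ => Commute.sum_right _ _ _ fun j _ => ?_).eq
    exact ((show Commute (X i) (X j) from hX i j).smul_left _).smul_right _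
  have hZY : ∀ k l, Z k * Y l = -(Y l * Z k) := fun k l => by
    simp [hY, Finset.mul_sum, Finset.sum_mul, hZX]
  have hZE : ∀ k l, Z k * E l = -(E l * Z k) := fun k l => by
    simp [hE, Finset.mul_sum, Finset.sum_mul, hZD]
  have hEY : ∀ k l, E k * Y l = -(Y l * E k) := fun k l => by
    simp only [hE, hY, Finset.mul_sum, Finset.sum_mul, ← Finset.sum_neg_distrib]
    rw [Finset.sum_comm]
    refine Finset.sum_congr rfl fun i _ => Finset.sum_congr rfl fun j _ => ?_
    rw [smul_mul_smul_comm, smul_mul_smul_comm, hDX, smul_neg, mul_comm]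
  have hsplit : ∑ k, (∑ i, M i k • (D i + X i)) * Z k = ∑ k, Y k * Z k + ∑ k, E k * Z k := by
    simp only [smul_add, Finset.sum_add_distrib, add_mul, hE, hY]
    rw [add_comm]
  set P := ∑ k, E k * Z k with hP
  set Q := ∑ k, Y k * Z k with hQ
  have hQP : Commute Q P := by
    refine Commute.sum_left _ _ _ fun k _ => Commute.sum_right _ _ _ fun l _ => ?_
    rw [commute_iff_eq]
    calc Y k * Z k * (E l * Z l) = Y k * (Z k * E l) * Z l := by noncomm_ring
      _ = -(Y k * E l * (Z k * Z l)) := by rw [hZE]; noncomm_ring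
      _ = -(E l * Y k * (Z l * Z k)) := by rw [hEY, hZ k l]; noncomm_ring
      _ = E l * (-(Y k * Z l)) * Z k := by noncomm_ring
      _ = E l * Z l * (Y k * Z k) := by rw [← hZY]; noncomm_ring
  -- The products `Y k * Y l` are symmetric and `Z k * Z l` antisymmetric in `k, l`, so the double
  -- sum equals its own negative. Thus no term with two `X`s survives.
  have hQQ : Q * Q = 0 := by
    have e : ∀ k l, Y k * Z k * (Y l * Z l) = -(Y k * Y l * (Z k * Z l)) := fun k l => by
      rw [mul_assoc, ← mul_assoc (Z k), hZY]
      noncomm_ring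
    have key : Q * Q = -(Q * Q) := by
      conv_lhs => rw [hQ, Finset.sum_mul_sum, Finset.sum_comm]
      rw [hQ, Finset.sum_mul_sum, ← Finset.sum_neg_distrib]
      refine Finset.sum_congr rfl fun k _ => ?_
      rw [← Finset.sum_neg_distrib]
      refine Finset.sum_congr rfl fun l _ => ?_
      rw [e, e, hYY l k, hZ l k]
      noncomm_ring
    have h2 : (2 : ℂ) • (Q * Q) = 0 := by
      rw [two_smul]
      nth_rewrite 1 [key]
      exact neg_add_cancel _
    exact (smul_eq_zero_iff_right (two_ne_zero)).1 h2
  -- As `Q * Q = 0`, only the part of the power linear in `X` matters, and it is the derivative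
  -- along `D + εX`. With `ε² = 0` the elements `D i + εX i` anticommute although the `X i` commute,
  -- so the determinant formula applies to them.
  let F : Fin n → DualNumber A := fun i => TrivSqZeroExt.inl (D i) + TrivSqZeroExt.inr (X i)
  have hF : ∀ i j, F i * F j = -(F j * F i) := fun i j => by
    ext
    · simpa [F] using hD i j
    · simp only [F, TrivSqZeroExt.snd_mul, TrivSqZeroExt.snd_add, TrivSqZeroExt.snd_inl,
        TrivSqZeroExt.snd_inr, TrivSqZeroExt.fst_add, TrivSqZeroExt.fst_inl,
        TrivSqZeroExt.fst_inr, TrivSqZeroExt.snd_neg, zero_add, add_zero, smul_eq_mul,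
        MulOpposite.smul_eq_mul_unop, MulOpposite.unop_op, hDX]
      abel
  have hZ' : ∀ i k, (TrivSqZeroExt.inl (Z i) : DualNumber A) * TrivSqZeroExt.inl (Z k) =
      -(TrivSqZeroExt.inl (Z k) * TrivSqZeroExt.inl (Z i)) := fun i k => by
    rw [← TrivSqZeroExt.inl_mul, hZ, TrivSqZeroExt.inl_neg, TrivSqZeroExt.inl_mul]
  have hFZ : ∀ i k, F i * TrivSqZeroExt.inl (Z k) = -(TrivSqZeroExt.inl (Z k) * F i) :=
    fun i k => by
      ext
      · simpa [F] using hDZ i k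
      · simpa [F] using hXZ i k
  have hT : ∀ k l, (∑ i, M i k • F i) * (∑ i, M i l • F i) =
      -((∑ i, M i l • F i) * (∑ i, M i k • F i)) := fun k l => by
    simp only [Finset.mul_sum, Finset.sum_mul, ← Finset.sum_neg_distrib]
    rw [Finset.sum_comm]
    refine Finset.sum_congr rfl fun i _ => Finset.sum_congr rfl fun j _ => ?_
    rw [smul_mul_smul_comm, smul_mul_smul_comm, hF, smul_neg, mul_comm]
  have hTZ : ∀ k l, (∑ i, M i k • F i) * TrivSqZeroExt.inl (Z l) =
      -(TrivSqZeroExt.inl (Z l) * ∑ i, M i k • F i) := fun k l => by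
    simp [Finset.mul_sum, Finset.sum_mul, hFZ]
  have main := sum_mul_pow hT (fun i => sum_smul_mul_self_eq_zero hF _) hZ' hTZ
  rw [prod_ofFn_sum_smul hF, prod_ofFn_inl_add_inr] at main
  have hPQ : ∑ k, (∑ i, M i k • F i) * (TrivSqZeroExt.inl (Z k) : DualNumber A) =
      TrivSqZeroExt.inl P + TrivSqZeroExt.inr Q := by
    ext
    · simp [F, hP, hE, TrivSqZeroExt.fst_sum]
    · simp [F, hQ, hY, TrivSqZeroExt.snd_sum]
  have hZp : (List.ofFn fun k => (TrivSqZeroExt.inl (Z k) : DualNumber A)).prod =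
      TrivSqZeroExt.inl (List.ofFn Z).prod := by
    rw [← TrivSqZeroExt.inlHom_apply (R := A) (M := A), map_list_prod, List.map_ofFn]
    rfl
  rw [hPQ, hZp] at main
  have hscal : ∀ (k m : ℕ) (c : ℂ) (x y : DualNumber A),
      (k : DualNumber A) * ((-1) ^ m * (c • x * y)) = ((k : ℂ) * (-1) ^ m * c) • (x * y) := by
    intro k m c x y
    rw [← nsmul_eq_mul, ← Nat.cast_smul_eq_nsmul ℂ, smul_mul_assoc, mul_assoc, mul_smul]
    rcases Nat.even_or_odd m with h | h <;> simp [h.neg_one_pow]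
  rw [hscal] at main
  set κ := (n.factorial : ℂ) * (-1) ^ (n * (n - 1) / 2) * M.det
  have h1 : P ^ n = κ • ((List.ofFn D).prod * (List.ofFn Z).prod) := by
    simpa using congrArg TrivSqZeroExt.fst main
  have h2 := congrArg TrivSqZeroExt.snd main
  rw [TrivSqZeroExt.snd_pow_of_smul_comm _ _ (by simpa using hQP.eq)] at h2
  rw [hsplit, add_mul, smul_add, ← h1]
  rcases n with _ | m
  · simp
  -- The linear term `n Q P^(n-1)` is the infinitesimal part of `(P + εQ)^n`.
  · rw [add_pow_succ_of_mul_self_eq_zero hQP hQQ, add_right_inj, (hQP.pow_right m).eq]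
    simpa using h2
end Grassmann
-- Right multiplication operators and their commutation relations.
section RightMultiplication

variable {n : ℕ}

theorem commSign_comm (k l : Gen n) : commSign k l = commSign l k := by
  simp only [commSign, mul_comm]

theorem commSign_mul_self (k l : Gen n) : commSign k l * commSign k l = 1 := by
  rw [commSign, ← pow_add, ← two_mul, pow_mul]
  simp

theorem mulSign_zero_left (b : Gen n → ℕ) : mulSign 0 b = 1 := by
  simp [mulSign]

theorem mulSign_zero_right (a : Gen n → ℕ) : mulSign a 0 = 1 := by
  simp [mulSign]

/-- The sign is a bicharacter in the exponents; this reduces every sign below to signs of pairs of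
generators. -/
theorem mulSign_add_left (a b c : Gen n → ℕ) :
    mulSign (a + b) c = mulSign a c * mulSign b c := by
  simp only [mulSign, ← Finset.prod_mul_distrib]
  refine Finset.prod_congr rfl fun k _ => Finset.prod_congr rfl fun l _ => ?_
  split_ifs <;> simp [add_mul, pow_add]

theorem mulSign_add_right (a b c : Gen n → ℕ) :
    mulSign a (b + c) = mulSign a b * mulSign a c := by
  simp only [mulSign, ← Finset.prod_mul_distrib]
  refine Finset.prod_congr rfl fun k _ => Finset.prod_congr rfl fun l _ => ?_
  split_ifs <;> simp [mul_add, pow_add]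

theorem mulSign_single_single (k l : Gen n) :
    mulSign (Pi.single k 1) (Pi.single l 1) = if l < k then commSign k l else 1 := by
  rw [mulSign, Finset.prod_eq_single k, Finset.prod_eq_single l]
  · simp
  · intro m _ hm
    simp [hm]
  · simp
  · intro m _ hm
    simp [hm]
  · simp

theorem IsMonomial.of_add_left {a b : Gen n → ℕ} (h : IsMonomial (a + b)) : IsMonomial a :=
  fun k hk => le_trans (Nat.le_add_right _ _) (h k hk)

theorem IsMonomial.mono {a b : Gen n → ℕ} (h : IsMonomial b) (hab : a ≤ b) : IsMonomial a :=
  fun k hk => le_trans (hab k) (h k hk)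

theorem isMonomial_of_le_one {a : Gen n → ℕ} (h : ∀ k, a k ≤ 1) : IsMonomial a := fun k _ => h k

theorem exists_eq_add_single {c : Gen n → ℕ} {k : Gen n} (h : c k ≠ 0) :
    ∃ d : Gen n → ℕ, c = d + Pi.single k 1 := by
  refine ⟨c - Pi.single k 1, (tsub_add_cancel_of_le fun l => ?_).symm⟩
  by_cases hl : l = k
  · subst hl
    simpa using Nat.one_le_iff_ne_zero.2 h
  · simp [hl]

open Classical in
/-- Multiplication by a generator on the right, on the coefficients at a point. -/
noncomputable def rightMul (k : Gen n) : Module.End ℂ ((Gen n → ℕ) → ℂ) where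
  toFun F c := if c k ≠ 0 ∧ IsMonomial c then
    (mulSign (c - Pi.single k 1) (Pi.single k 1) : ℂ) * F (c - Pi.single k 1) else 0
  map_add' F G := by
    funext c
    simp only [Pi.add_apply]
    split_ifs <;> simp [mul_add]
  map_smul' r F := by
    funext c
    simp only [Pi.smul_apply, RingHom.id_apply, smul_eq_mul]
    split_ifs <;> ring

theorem rightMul_apply_of_eq_zero {k : Gen n} {c : Gen n → ℕ} (F : (Gen n → ℕ) → ℂ)
    (h : c k = 0) : rightMul k F c = 0 := by
  simp [rightMul, h]

theorem rightMul_apply_of_not_isMonomial {k : Gen n} {c : Gen n → ℕ} (F : (Gen n → ℕ) → ℂ)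
    (h : ¬ IsMonomial c) : rightMul k F c = 0 := by
  simp [rightMul, h]

theorem rightMul_apply_add {k : Gen n} {d : Gen n → ℕ} (F : (Gen n → ℕ) → ℂ)
    (h : IsMonomial (d + Pi.single k 1)) :
    rightMul k F (d + Pi.single k 1) = (mulSign d (Pi.single k 1) : ℂ) * F d := by
  simp [rightMul, h]

/-- The operators of right multiplication, composed in the order of the product of forms. -/
noncomputable def rightOp (k : Gen n) : (Module.End ℂ ((Gen n → ℕ) → ℂ))ᵐᵒᵖ :=
  MulOpposite.op (rightMul k)

theorem rightMul_rightMul_apply {k l : Gen n} (F : (Gen n → ℕ) → ℂ) {d : Gen n → ℕ}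
    (h : IsMonomial (d + Pi.single k 1 + Pi.single l 1)) :
    rightMul l (rightMul k F) (d + Pi.single k 1 + Pi.single l 1) =
      (mulSign (Pi.single k 1) (Pi.single l 1) : ℂ) *
        ((mulSign d (Pi.single k 1) : ℂ) * (mulSign d (Pi.single l 1) : ℂ) * F d) := by
  rw [rightMul_apply_add _ h, rightMul_apply_add _ h.of_add_left, mulSign_add_left]
  push_cast
  ring

theorem rightMul_rightMul_of_eq_zero {k l : Gen n} (F : (Gen n → ℕ) → ℂ) {c : Gen n → ℕ}
    (h : c k = 0 ∨ c l = 0) (hkl : k ≠ l) : rightMul l (rightMul k F) c = 0 := by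
  by_cases hl : c l = 0
  · exact rightMul_apply_of_eq_zero _ hl
  · obtain ⟨d, rfl⟩ := exists_eq_add_single hl
    by_cases hm : IsMonomial (d + Pi.single l 1)
    · rw [rightMul_apply_add _ hm, rightMul_apply_of_eq_zero, mul_zero]
      simpa [hkl, hl] using h
    · exact rightMul_apply_of_not_isMonomial _ hm

/-- Both orders read the same coefficient with the same two signs. They differ only by the sign of
one generator against the other, which is `commSign` in one order and `1` in the other. -/
theorem rightOp_mul_rightOp_of_ne {k l : Gen n} (hkl : k ≠ l) :
    rightOp k * rightOp l = commSign k l • (rightOp l * rightOp k) := by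
  apply MulOpposite.unop_injective
  refine LinearMap.ext fun F => funext fun c => ?_
  change rightMul l (rightMul k F) c = (commSign k l • (rightMul k * rightMul l)) F c
  rw [LinearMap.smul_apply, Pi.smul_apply, zsmul_eq_mul]
  change _ = _ * rightMul k (rightMul l F) c
  by_cases h0 : c k = 0 ∨ c l = 0
  · rw [rightMul_rightMul_of_eq_zero F h0 hkl, rightMul_rightMul_of_eq_zero F h0.symm hkl.symm,
      mul_zero]
  push Not at h0
  obtain ⟨d', rfl⟩ := exists_eq_add_single h0.2
  obtain ⟨d, rfl⟩ := exists_eq_add_single (c := d') (k := k) (by simpa [hkl] using h0.1)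
  by_cases hm : IsMonomial (d + Pi.single k 1 + Pi.single l 1)
  · rw [rightMul_rightMul_apply F hm]
    rw [add_right_comm] at hm ⊢
    rw [rightMul_rightMul_apply F hm, mulSign_single_single, mulSign_single_single,
      commSign_comm k l]
    have hs := congrArg (fun x : ℤ => (x : ℂ)) (commSign_mul_self l k)
    push_cast at hs
    rcases lt_or_gt_of_ne hkl with h | h
    · rw [if_neg h.asymm, if_pos h, ← mul_assoc (commSign l k : ℂ), hs]
      push_cast
      ring
    · rw [if_pos h, if_neg h.asymm, commSign_comm l k]
      push_cast
      ring
  · rw [rightMul_apply_of_not_isMonomial _ hm, rightMul_apply_of_not_isMonomial _ hm, mul_zero]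

theorem rightOp_mul_self {k : Gen n} (hk : commSign k k = -1) : rightOp k * rightOp k = 0 := by
  apply MulOpposite.unop_injective
  refine LinearMap.ext fun F => funext fun c => ?_
  change rightMul k (rightMul k F) c = 0
  by_cases h0 : c k = 0
  · exact rightMul_apply_of_eq_zero _ h0
  obtain ⟨d, rfl⟩ := exists_eq_add_single h0
  by_cases hm : IsMonomial (d + Pi.single k 1)
  · rw [rightMul_apply_add _ hm, rightMul_apply_of_eq_zero, mul_zero]
    have := hm k hk
    simp at this
    exact this
  · exact rightMul_apply_of_not_isMonomial _ hm

theorem rightOp_anticomm {k l : Gen n} (h : commSign k l = -1) :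
    rightOp k * rightOp l = -(rightOp l * rightOp k) := by
  by_cases hkl : k = l
  · subst hkl
    rw [rightOp_mul_self h, neg_zero]
  · rw [rightOp_mul_rightOp_of_ne hkl, h, neg_one_zsmul]

theorem rightOp_comm {k l : Gen n} (h : commSign k l = 1) :
    rightOp k * rightOp l = rightOp l * rightOp k := by
  by_cases hkl : k = l
  · rw [hkl]
  · rw [rightOp_mul_rightOp_of_ne hkl, h, one_zsmul]

-- Right multiplication by `k` and then by `l` agrees with the convolution formula of `wedge` for
-- the single monomial `k ∧ l`; no sign appears because `k < l`.
open Classical in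
theorem unop_rightOp_mul_rightOp {k l : Gen n} (hkl : k < l) (F : (Gen n → ℕ) → ℂ)
    (c : Gen n → ℕ) :
    (rightOp k * rightOp l).unop F c = if IsMonomial c then
      ∑ a ∈ Finset.Iic c, (mulSign a (c - a) : ℂ) *
        ((if c - a = Pi.single k 1 + Pi.single l 1 then 1 else 0) * F a) else 0 := by
  change rightMul l (rightMul k F) c = _
  split_ifs with hm
  swap
  · exact rightMul_apply_of_not_isMonomial _ hm
  by_cases h0 : c k = 0 ∨ c l = 0
  · rw [rightMul_rightMul_of_eq_zero F h0 hkl.ne, Finset.sum_eq_zero]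
    intro a ha
    rw [if_neg, zero_mul, mul_zero]
    intro h
    rcases h0 with h0 | h0
    · have := congrFun h k
      simp [h0] at this
      omega
    · have := congrFun h l
      simp [h0] at this
  push Not at h0
  obtain ⟨d', rfl⟩ := exists_eq_add_single h0.2
  obtain ⟨d, rfl⟩ := exists_eq_add_single (c := d') (k := k) (by simpa [hkl.ne] using h0.1)
  rw [rightMul_rightMul_apply F hm, Finset.sum_eq_single d]
  · rw [mulSign_single_single, if_neg hkl.asymm, add_assoc, add_tsub_cancel_left, if_pos rfl,
      mulSign_add_right]
    push_cast
    ring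
  · intro a ha hne
    rw [if_neg, zero_mul, mul_zero]
    intro h
    apply hne
    have h1 := tsub_add_cancel_of_le (Finset.mem_Iic.1 ha)
    rw [h, add_assoc d, add_comm d] at h1
    exact add_left_cancel h1
  · intro h
    exact absurd (Finset.mem_Iic.2 (by rw [add_assoc]; exact le_self_add)) h

theorem coeff_of_isMonomial {M : Type} [AddCommGroup M] [Module ℂ M] (Φ : Superform n M)
    {a : Gen n → ℕ} (h : IsMonomial a) : coeff Φ a = Φ ⟨a, h⟩ := dif_pos h

theorem coeff_of_not_isMonomial {M : Type} [AddCommGroup M] [Module ℂ M] (Φ : Superform n M)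
    {a : Gen n → ℕ} (h : ¬ IsMonomial a) : coeff Φ a = 0 := dif_neg h

theorem coeff_wedge {M : Type} [AddCommGroup M] [Module ℂ M] (Φ : Superform n M)
    (Ψ : Superform n ℂ) {c : Gen n → ℕ} (h : IsMonomial c) (z : Fin n → ℂ) :
    coeff (wedge Φ Ψ) c z =
      ∑ a ∈ Finset.Iic c, mulSign a (c - a) • (coeff Ψ (c - a) z • coeff Φ a z) := by
  rw [coeff_of_isMonomial _ h, wedge]

/-- Right multiplication by `∑_k (∑_i M_ik (dz_i + dξ_i)) ∧ dz̄_k`. -/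
noncomputable def quadraticOp (M : Matrix (Fin n) (Fin n) ℂ) :
    (Module.End ℂ ((Gen n → ℕ) → ℂ))ᵐᵒᵖ :=
  ∑ k, (∑ i, M i k • (rightOp (dz i) + rightOp (dxi i))) * rightOp (dzBar k)

open Classical in
/-- The coefficients of `∑_k (∑_i M_ik (dz_i + dξ_i)) ∧ dz̄_k`. -/
noncomputable def quadraticCoeff (M : Matrix (Fin n) (Fin n) ℂ) (b : Gen n → ℕ) : ℂ :=
  ∑ k, ∑ i, M i k * ((if b = Pi.single (dz i) 1 + Pi.single (dzBar k) 1 then 1 else 0) -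
    (if b = Pi.single (dzBar k) 1 + Pi.single (dxi i) 1 then 1 else 0))

theorem dz_lt_dzBar (i k : Fin n) : dz i < dzBar k :=
  Prod.Lex.toLex_lt_toLex.2 (Or.inl (by simp))

theorem dz_lt_dxi (i k : Fin n) : dz i < dxi k :=
  Prod.Lex.toLex_lt_toLex.2 (Or.inl (by simp))

theorem dzBar_lt_dxi (i k : Fin n) : dzBar i < dxi k :=
  Prod.Lex.toLex_lt_toLex.2 (Or.inl (by simp))

theorem commSign_dz_dz (i k : Fin n) : commSign (dz i) (dz k) = -1 := rfl
theorem commSign_dz_dzBar (i k : Fin n) : commSign (dz i) (dzBar k) = -1 := rfl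
theorem commSign_dz_dxi (i k : Fin n) : commSign (dz i) (dxi k) = -1 := rfl
theorem commSign_dzBar_dzBar (i k : Fin n) : commSign (dzBar i) (dzBar k) = -1 := rfl
theorem commSign_dxi_dzBar (i k : Fin n) : commSign (dxi i) (dzBar k) = -1 := rfl
theorem commSign_dxi_dxi (i k : Fin n) : commSign (dxi i) (dxi k) = 1 := by
  simp [commSign, formDegree, parity, dxi]

/-- This is the bridge from forms to operators: multiplying by a form with the coefficients of the
quadratic expression is an application of `quadraticOp`. -/
theorem coeff_wedge_quadratic (M : Matrix (Fin n) (Fin n) ℂ) (Φ Ψ : Superform n ℂ)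
    (z : Fin n → ℂ) (hΨ : ∀ b, IsMonomial b → coeff Ψ b z = quadraticCoeff M b) :
    (fun c => coeff (wedge Φ Ψ) c z) = (quadraticOp M).unop fun c => coeff Φ c z := by
  classical
  funext c
  -- Sorting `dξ_i ∧ dz̄_k` into increasing order produces the minus sign found in `quadraticCoeff`.
  have hexp : quadraticOp M = ∑ k, ∑ i, M i k •
      (rightOp (dz i) * rightOp (dzBar k) - rightOp (dzBar k) * rightOp (dxi i)) := by
    simp only [quadraticOp, Finset.sum_mul, smul_mul_assoc, add_mul,
      rightOp_anticomm (commSign_dxi_dzBar _ _), sub_eq_add_neg]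
  rw [hexp]
  simp only [Finset.unop_sum, MulOpposite.unop_smul, MulOpposite.unop_sub,
    LinearMap.sum_apply, LinearMap.smul_apply, LinearMap.sub_apply, Finset.sum_apply,
    Pi.smul_apply, Pi.sub_apply, unop_rightOp_mul_rightOp (dz_lt_dzBar _ _),
    unop_rightOp_mul_rightOp (dzBar_lt_dxi _ _), smul_eq_mul]
  by_cases hm : IsMonomial c
  swap
  · simp [coeff_of_not_isMonomial _ hm, hm]
  simp only [if_pos hm]
  rw [coeff_wedge _ _ hm]
  have h1 : ∀ a ∈ Finset.Iic c, mulSign a (c - a) • (coeff Ψ (c - a) z • coeff Φ a z) =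
      (mulSign a (c - a) : ℂ) * (quadraticCoeff M (c - a) * coeff Φ a z) := fun a ha => by
    rw [hΨ _ (hm.mono tsub_le_self), zsmul_eq_mul, smul_eq_mul]
  rw [Finset.sum_congr rfl h1]
  simp only [quadraticCoeff, Finset.sum_mul, Finset.mul_sum, ← Finset.sum_sub_distrib]
  rw [Finset.sum_comm]
  refine Finset.sum_congr rfl fun k _ => ?_
  rw [Finset.sum_comm]
  refine Finset.sum_congr rfl fun i _ => Finset.sum_congr rfl fun a _ => ?_
  ring

theorem coeff_ofFun (f : (Fin n → ℂ) → ℂ) (a : Gen n → ℕ) (z : Fin n → ℂ) :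
    coeff (ofFun f) a z = if a = 0 then f z else 0 := by
  by_cases h : IsMonomial a
  · rw [coeff_of_isMonomial _ h]
    simp only [ofFun]
  · rw [coeff_of_not_isMonomial _ h, if_neg]
    · rfl
    · rintro rfl
      exact h fun k _ => by simp

theorem quadraticOp_pow (M : Matrix (Fin n) (Fin n) ℂ) :
    quadraticOp M ^ n = ((n.factorial : ℂ) * (-1) ^ (n * (n - 1) / 2) * M.det) •
      (((List.ofFn fun i => rightOp (dz i)).prod + ∑ j, (List.ofFn (Function.update
        (fun i => rightOp (dz i)) j (rightOp (dxi j)))).prod) *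
          (List.ofFn fun i => rightOp (dzBar i)).prod) :=
  sum_smul_add_mul_pow (fun i k => rightOp_anticomm (commSign_dz_dz i k))
    (fun i k => rightOp_anticomm (commSign_dzBar_dzBar i k))
    (fun i k => rightOp_comm (commSign_dxi_dxi i k))
    (fun i k => rightOp_anticomm (commSign_dz_dxi i k))
    (fun i k => rightOp_anticomm (commSign_dz_dzBar i k))
    (fun i k => rightOp_anticomm (commSign_dxi_dzBar i k)) M

end RightMultiplication
-- Signs of the surviving monomials.
section Words

variable {n : ℕ}

theorem mulSign_sum_left {ι : Type*} (s : Finset ι) (a : ι → Gen n → ℕ) (b : Gen n → ℕ) :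
    mulSign (∑ i ∈ s, a i) b = ∏ i ∈ s, mulSign (a i) b := by
  classical
  induction s using Finset.induction_on with
  | empty => simp [mulSign_zero_left]
  | insert i s hi ih => rw [Finset.sum_insert hi, Finset.prod_insert hi, mulSign_add_left, ih]

theorem mulSign_sum_right {ι : Type*} (s : Finset ι) (a : Gen n → ℕ) (b : ι → Gen n → ℕ) :
    mulSign a (∑ i ∈ s, b i) = ∏ i ∈ s, mulSign a (b i) := by
  classical
  induction s using Finset.induction_on with
  | empty => simp [mulSign_zero_right]
  | insert i s hi ih => rw [Finset.sum_insert hi, Finset.prod_insert hi, mulSign_add_right, ih]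

theorem rightMul_single {a : Gen n → ℕ} {k : Gen n} (h : IsMonomial (a + Pi.single k 1)) :
    rightMul k (Pi.single a 1) =
      (mulSign a (Pi.single k 1) : ℂ) • Pi.single (a + Pi.single k 1) (1 : ℂ) := by
  funext c
  rw [Pi.smul_apply, smul_eq_mul]
  by_cases hc : c k = 0
  · rw [rightMul_apply_of_eq_zero _ hc, Pi.single_eq_of_ne, mul_zero]
    rintro rfl
    simp at hc
  obtain ⟨d, rfl⟩ := exists_eq_add_single hc
  by_cases hd : d = a
  · subst hd
    rw [rightMul_apply_add _ h, Pi.single_eq_same, Pi.single_eq_same]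
  · rw [Pi.single_eq_of_ne (by simpa using hd), mul_zero]
    by_cases hm : IsMonomial (d + Pi.single k 1)
    · rw [rightMul_apply_add _ hm, Pi.single_eq_of_ne hd, mul_zero]
    · exact rightMul_apply_of_not_isMonomial _ hm

/-- Each letter passes the larger generators of `a` and the larger letters before it. Admissibility
of the final monomial forces that of all intermediate ones. -/
theorem prod_rightOp_single : ∀ {m : ℕ} (f : Fin m → Gen n) (a : Gen n → ℕ)
    (_ : IsMonomial (a + ∑ i, Pi.single (f i) 1)),
    (List.ofFn fun i => rightOp (f i)).prod.unop (Pi.single a 1) =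
      ((mulSign a (∑ i, Pi.single (f i) 1) * ∏ i, ∏ j,
        if i < j then mulSign (Pi.single (f i) 1) (Pi.single (f j) 1) else 1 : ℤ) : ℂ) •
        Pi.single (a + ∑ i, Pi.single (f i) 1) (1 : ℂ)
  | 0, f, a, _ => by simp [mulSign_zero_right]
  | m + 1, f, a, h => by
    rw [Fin.sum_univ_succ] at h ⊢
    rw [← add_assoc] at h
    rw [List.ofFn_succ, List.prod_cons]
    change (List.ofFn fun i : Fin m => rightOp (f i.succ)).prod.unop
      (rightMul (f 0) (Pi.single a 1)) = _
    rw [rightMul_single h.of_add_left, map_smul, prod_rightOp_single _ _ h, smul_smul,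
      ← add_assoc]
    congr 1
    rw [Fin.prod_univ_succ]
    simp only [Fin.prod_univ_succ, lt_irrefl, if_false, Fin.succ_pos, if_true, one_mul,
      Fin.not_lt_zero, Fin.succ_lt_succ_iff]
    rw [mulSign_add_right, mulSign_add_left, mulSign_sum_right _ (Pi.single (f 0) 1)]
    push_cast
    ring

theorem mulSign_single_of_lt {k l : Gen n} (h : k < l) :
    mulSign (Pi.single k 1) (Pi.single l 1) = 1 := by
  rw [mulSign_single_single, if_neg h.asymm]

theorem mulSign_single_of_gt {k l : Gen n} (h : l < k) :
    mulSign (Pi.single k 1) (Pi.single l 1) = commSign k l := by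
  rw [mulSign_single_single, if_pos h]

theorem mulSign_single_single_of_commSign {k l : Gen n} (h : commSign k l = 1) :
    mulSign (Pi.single k 1) (Pi.single l 1) = 1 := by
  rw [mulSign_single_single, h, ite_self]

theorem dz_lt_dz {i j : Fin n} (h : i < j) : dz i < dz j :=
  Prod.Lex.toLex_lt_toLex.2 (Or.inr ⟨rfl, h⟩)

theorem dzBar_lt_dzBar {i j : Fin n} (h : i < j) : dzBar i < dzBar j :=
  Prod.Lex.toLex_lt_toLex.2 (Or.inr ⟨rfl, h⟩)

theorem commSign_dxi_dz (i k : Fin n) : commSign (dxi i) (dz k) = -1 := rfl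

/-- The exponents of `dz_1 ⋯ dz_n dz̄_1 ⋯ dz̄_n`. -/
def bodyMonomial : Gen n → ℕ := ∑ i, Pi.single (dz i) 1 + ∑ i, Pi.single (dzBar i) 1

/-- The exponents of `dz_1 ⋯ (no dz_j) ⋯ dz_n dz̄_1 ⋯ dz̄_n dξ_j`. -/
def exchangedMonomial (j : Fin n) : Gen n → ℕ :=
  ∑ i, Pi.single (Function.update dz j (dxi j) i) 1 + ∑ i, Pi.single (dzBar i) 1

/-- Adding the swapped generators to the two sides avoids truncated subtraction of exponents;
`mixedMonomial_add` follows the same pattern. -/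
theorem exchangedMonomial_add (j : Fin n) :
    exchangedMonomial j + Pi.single (dz j) 1 = bodyMonomial + Pi.single (dxi j) 1 := by
  have h : (∑ i, Pi.single (Function.update dz j (dxi j) i) 1 : Gen n → ℕ) + Pi.single (dz j) 1 =
      ∑ i, Pi.single (dz i) 1 + Pi.single (dxi j) 1 := by
    rw [← Finset.add_sum_erase _ _ (Finset.mem_univ j),
      ← Finset.add_sum_erase _ (fun i => (Pi.single (dz i) 1 : Gen n → ℕ)) (Finset.mem_univ j),
      Function.update_self]
    have : ∑ i ∈ Finset.univ.erase j, (Pi.single (Function.update dz j (dxi j) i) 1 : Gen n → ℕ) =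
        ∑ i ∈ Finset.univ.erase j, Pi.single (dz i) 1 :=
      Finset.sum_congr rfl fun i hi => by rw [Function.update_of_ne (Finset.ne_of_mem_erase hi)]
    rw [this]
    abel
  rw [exchangedMonomial, bodyMonomial, add_right_comm, h]
  abel

theorem sum_single_apply (f : Fin n → Gen n) (hf : Function.Injective f) (k : Gen n) :
    (∑ i, Pi.single (f i) 1 : Gen n → ℕ) k = if ∃ i, f i = k then 1 else 0 := by
  classical
  rw [Finset.sum_apply]
  split_ifs with h
  · obtain ⟨i, rfl⟩ := h
    rw [Finset.sum_eq_single i]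
    · simp
    · intro j _ hj
      rw [Pi.single_eq_of_ne fun h => hj (hf h).symm]
    · simp
  · exact Finset.sum_eq_zero fun i _ => Pi.single_eq_of_ne (fun h' => h ⟨i, h'.symm⟩) _

theorem sum_single_toLex_apply (r : Fin 6) (k : Gen n) :
    (∑ i, Pi.single (toLex (r, i)) 1 : Gen n → ℕ) k = if (ofLex k).1 = r then 1 else 0 := by
  rw [sum_single_apply _ fun i j h => by simpa using h]
  congr 1
  apply propext
  constructor
  · rintro ⟨i, rfl⟩
    rfl
  · rintro rfl
    exact ⟨(ofLex k).2, rfl⟩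

theorem bodyMonomial_apply (k : Gen n) :
    bodyMonomial k = if (ofLex k).1 < 2 then 1 else 0 := by
  change (∑ i, Pi.single (toLex (0, i)) 1 : Gen n → ℕ) k +
    (∑ i, Pi.single (toLex (1, i)) 1 : Gen n → ℕ) k = _
  rw [sum_single_toLex_apply, sum_single_toLex_apply]
  generalize (ofLex k).1 = r
  revert r
  decide

theorem fermiMonomial_eq : (fermiMonomial : Gen n → ℕ) = ∑ i, Pi.single (dxi i) 1 +
    ∑ i, Pi.single (dxiBar i) 1 + ∑ i, Pi.single (xi i) 1 + ∑ i, Pi.single (xiBar i) 1 := by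
  funext k
  change _ = (∑ i, Pi.single (toLex (2, i)) 1 : Gen n → ℕ) k +
    (∑ i, Pi.single (toLex (3, i)) 1 : Gen n → ℕ) k +
    (∑ i, Pi.single (toLex (4, i)) 1 : Gen n → ℕ) k +
    (∑ i, Pi.single (toLex (5, i)) 1 : Gen n → ℕ) k
  rw [sum_single_toLex_apply, sum_single_toLex_apply, sum_single_toLex_apply,
    sum_single_toLex_apply, fermiMonomial]
  generalize (ofLex k).1 = r
  revert r
  decide

theorem bodyMonomial_add_fermiMonomial : (bodyMonomial + fermiMonomial : Gen n → ℕ) =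
    topMonomial := by
  funext k
  rw [Pi.add_apply, bodyMonomial_apply, fermiMonomial, topMonomial]
  split_ifs <;> rfl

theorem dz_ne_dxi (i j : Fin n) : dz i ≠ dxi j := (dz_lt_dxi i j).ne

theorem mixedMonomial_add (j : Fin n) :
    mixedMonomial j + Pi.single (dxi j) 1 = Pi.single (dz j) 1 + fermiMonomial := by
  funext k
  simp only [Pi.add_apply, mixedMonomial, Pi.single_apply]
  by_cases h1 : k = dz j
  · subst h1
    have : fermiMonomial (dz j) = 0 := by simp [fermiMonomial, dz]
    simp [dz_ne_dxi, this]
  · by_cases h2 : k = dxi j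
    · subst h2
      have : fermiMonomial (dxi j) = 1 := by simp [fermiMonomial, dxi]
      simp [(dz_ne_dxi _ _).symm, this]
    · simp [h1, h2]

theorem exchangedMonomial_add_mixedMonomial (j : Fin n) :
    exchangedMonomial j + mixedMonomial j = topMonomial := by
  have h : exchangedMonomial j + mixedMonomial j + (Pi.single (dz j) 1 + Pi.single (dxi j) 1) =
      topMonomial + (Pi.single (dz j) 1 + Pi.single (dxi j) 1) := by
    rw [add_add_add_comm, exchangedMonomial_add, mixedMonomial_add,
      ← bodyMonomial_add_fermiMonomial]
    abel
  exact add_right_cancel h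

/-- With indices starting at `0`, `dz_j` passes exactly the `j` generators `dz_i` with `i < j`. -/
theorem mulSign_dz_bodyMonomial (j : Fin n) :
    mulSign (Pi.single (dz j) 1) bodyMonomial = (-1) ^ (j : ℕ) := by
  rw [bodyMonomial, mulSign_add_right, mulSign_sum_right, mulSign_sum_right]
  simp only [mulSign_single_of_lt (dz_lt_dzBar _ _), Finset.prod_const_one, mul_one]
  have : ∀ i, mulSign (Pi.single (dz j) 1) (Pi.single (dz i) 1) = if i < j then -1 else 1 :=
    fun i => by
      rw [mulSign_single_single, commSign_dz_dz]
      congr 1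
      simp [dz, Prod.Lex.toLex_lt_toLex]
  simp only [this, Finset.prod_ite, Finset.prod_const, one_pow, mul_one]
  rw [Finset.filter_gt_eq_Iio, Fin.card_Iio]

/-- A generator beyond the `dz̄` block passes `dz_i` and `dz̄_i` with equal signs, so the signs
cancel in pairs. -/
theorem mulSign_single_bodyMonomial {k : Gen n} (hk : 2 ≤ (ofLex k).1) :
    mulSign (Pi.single k 1) bodyMonomial = 1 := by
  rw [bodyMonomial, mulSign_add_right, mulSign_sum_right, mulSign_sum_right,
    ← Finset.prod_mul_distrib]
  refine Finset.prod_eq_one fun i _ => ?_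
  rw [mulSign_single_of_gt, mulSign_single_of_gt]
  · have : commSign k (dzBar i) = commSign k (dz i) := rfl
    rw [this, commSign_mul_self]
  · exact Prod.Lex.lt_iff.2 (Or.inl (lt_of_lt_of_le (by change (1 : Fin 6) < 2; decide) hk))
  · exact Prod.Lex.lt_iff.2 (Or.inl (lt_of_lt_of_le (by change (0 : Fin 6) < 2; decide) hk))

theorem mulSign_fermiMonomial_bodyMonomial :
    mulSign fermiMonomial (bodyMonomial : Gen n → ℕ) = 1 := by
  rw [fermiMonomial_eq]
  simp only [mulSign_add_left, mulSign_sum_left]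
  have h1 : ∀ i : Fin n, mulSign (Pi.single (dxi i) 1) bodyMonomial = 1 := fun i =>
    mulSign_single_bodyMonomial (by simp [dxi])
  have h2 : ∀ i : Fin n, mulSign (Pi.single (dxiBar i) 1) bodyMonomial = 1 := fun i =>
    mulSign_single_bodyMonomial (by simp [dxiBar])
  have h3 : ∀ i : Fin n, mulSign (Pi.single (xi i) 1) bodyMonomial = 1 := fun i =>
    mulSign_single_bodyMonomial (by simp [xi])
  have h4 : ∀ i : Fin n, mulSign (Pi.single (xiBar i) 1) bodyMonomial = 1 := fun i =>
    mulSign_single_bodyMonomial (by simp [xiBar])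
  simp [h1, h2, h3, h4]

/-- Only the `ξ` and the `ξ̄` contribute, with `(-1)^n` each. -/
theorem mulSign_fermiMonomial_dxi (j : Fin n) :
    mulSign fermiMonomial (Pi.single (dxi j) 1) = 1 := by
  rw [fermiMonomial_eq]
  simp only [mulSign_add_left, mulSign_sum_left]
  have h1 : ∀ i : Fin n, commSign (dxi i) (dxi j) = 1 := fun i => commSign_dxi_dxi i j
  have h2 : ∀ i : Fin n, commSign (dxiBar i) (dxi j) = 1 := fun i => by
    simp [commSign, formDegree, parity, dxi, dxiBar]
  have h3 : ∀ i : Fin n, mulSign (Pi.single (xi i) 1) (Pi.single (dxi j) 1) = -1 := fun i =>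
    mulSign_single_of_gt (Prod.Lex.toLex_lt_toLex.2 (Or.inl (by simp)))
  have h4 : ∀ i : Fin n, mulSign (Pi.single (xiBar i) 1) (Pi.single (dxi j) 1) = -1 := fun i =>
    mulSign_single_of_gt (Prod.Lex.toLex_lt_toLex.2 (Or.inl (by simp)))
  simp only [mulSign_single_single_of_commSign (h1 _), mulSign_single_single_of_commSign (h2 _),
    h3, h4, Finset.prod_const, one_pow, one_mul, ← mul_pow]
  simp

/-- The `dξ` and the `dξ̄` contribute `(-1)^n` each, and the `ξ, ξ̄` commute with `dz_j`. -/
theorem mulSign_fermiMonomial_dz (j : Fin n) :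
    mulSign fermiMonomial (Pi.single (dz j) 1) = 1 := by
  rw [fermiMonomial_eq]
  simp only [mulSign_add_left, mulSign_sum_left]
  have h1 : ∀ i : Fin n, mulSign (Pi.single (dxi i) 1) (Pi.single (dz j) 1) = -1 := fun i =>
    mulSign_single_of_gt (Prod.Lex.toLex_lt_toLex.2 (Or.inl (by simp)))
  have h2 : ∀ i : Fin n, mulSign (Pi.single (dxiBar i) 1) (Pi.single (dz j) 1) = -1 := fun i =>
    mulSign_single_of_gt (Prod.Lex.toLex_lt_toLex.2 (Or.inl (by simp)))
  have h3 : ∀ i : Fin n, commSign (xi i) (dz j) = 1 := fun i => rfl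
  have h4 : ∀ i : Fin n, commSign (xiBar i) (dz j) = 1 := fun i => rfl
  simp only [mulSign_single_single_of_commSign (h3 _), mulSign_single_single_of_commSign (h4 _),
    h1, h2, Finset.prod_const, one_pow, mul_one, ← mul_pow]
  simp

theorem mulSign_dxi_dz (i j : Fin n) :
    mulSign (Pi.single (dxi i) 1) (Pi.single (dz j) 1) = -1 := by
  rw [mulSign_single_of_gt (dz_lt_dxi _ _), commSign_dxi_dz]

/-- After adding `dξ_j` on the left and `dz_j` on the right, the sign is one between the body and
fermionic monomials. Bimultiplicativity then removes the contributions of the added generators. -/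
theorem mulSign_mixedMonomial_exchangedMonomial (j : Fin n) :
    mulSign (mixedMonomial j) (exchangedMonomial j) = -(-1) ^ (j : ℕ) := by
  have h1 : mulSign (mixedMonomial j + Pi.single (dxi j) 1)
      (exchangedMonomial j + Pi.single (dz j) 1) = (-1) ^ (j : ℕ) := by
    rw [mixedMonomial_add, exchangedMonomial_add]
    simp [mulSign_add_left, mulSign_add_right, mulSign_dz_bodyMonomial,
      mulSign_single_of_lt (dz_lt_dxi _ _), mulSign_fermiMonomial_bodyMonomial,
      mulSign_fermiMonomial_dxi]
  have h2 : mulSign (mixedMonomial j + Pi.single (dxi j) 1) (Pi.single (dz j) 1) = 1 := by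
    rw [mixedMonomial_add, mulSign_add_left, mulSign_fermiMonomial_dz, mul_one,
      mulSign_single_single, if_neg (lt_irrefl _)]
  have h3 : mulSign (Pi.single (dxi j) 1) (exchangedMonomial j + Pi.single (dz j) 1) = 1 := by
    rw [exchangedMonomial_add, mulSign_add_right, mulSign_single_bodyMonomial (by simp [dxi]),
      mulSign_single_single, if_neg (lt_irrefl _), one_mul]
  rw [mulSign_add_right, mulSign_dxi_dz] at h3
  rw [mulSign_add_right, h2, mulSign_add_left] at h1
  have h4 : mulSign (Pi.single (dxi j) 1) (exchangedMonomial j) = -1 := by linarith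
  rw [h4] at h1
  linarith

theorem topMonomial_isMonomial : IsMonomial (topMonomial : Gen n → ℕ) := fun _ _ => le_rfl

theorem unop_prod_rightOp_dzBar (a : Gen n → ℕ)
    (h : IsMonomial (a + ∑ i, Pi.single (dzBar i) 1)) :
    (List.ofFn fun i => rightOp (dzBar i)).prod.unop (Pi.single a 1) =
      (mulSign a (∑ i, Pi.single (dzBar i) 1) : ℂ) •
        Pi.single (a + ∑ i, Pi.single (dzBar i) 1) (1 : ℂ) := by
  rw [prod_rightOp_single _ _ h]
  congr 2
  rw [Finset.prod_eq_one, mul_one]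
  intro i _
  refine Finset.prod_eq_one fun k _ => ?_
  split_ifs with hik
  · exact mulSign_single_of_lt (dzBar_lt_dzBar hik)
  · rfl

theorem unop_prod_rightOp_body :
    ((List.ofFn fun i => rightOp (dz i)).prod *
      (List.ofFn fun i => rightOp (dzBar i)).prod).unop (Pi.single 0 1) =
      Pi.single (bodyMonomial : Gen n → ℕ) (1 : ℂ) := by
  have hm : IsMonomial (bodyMonomial : Gen n → ℕ) :=
    IsMonomial.of_add_left (b := fermiMonomial)
      (bodyMonomial_add_fermiMonomial ▸ topMonomial_isMonomial)
  change (List.ofFn fun i => rightOp (dzBar i)).prod.unop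
    ((List.ofFn fun i => rightOp (dz i)).prod.unop (Pi.single 0 1)) = _
  rw [prod_rightOp_single _ _ (by rw [zero_add]; exact hm.of_add_left), zero_add, map_smul,
    unop_prod_rightOp_dzBar _ hm, mulSign_zero_left, Finset.prod_eq_one, mulSign_sum_left,
    Finset.prod_eq_one, bodyMonomial]
  · simp
  · intro i _
    rw [mulSign_sum_right]
    exact Finset.prod_eq_one fun k _ => mulSign_single_of_lt (dz_lt_dzBar _ _)
  · intro i _
    refine Finset.prod_eq_one fun k _ => ?_
    split_ifs with hik
    · exact mulSign_single_of_lt (dz_lt_dz hik)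
    · rfl

/-- To reach its place, `dξ_j` passes the `n - 1 - j` later `dz` and all `n` of the `dz̄`, each with
sign `-1`; the total `2n - 1 - j` has the parity of `j + 1`. -/
theorem unop_prod_rightOp_exchanged (j : Fin n) :
    ((List.ofFn (Function.update (fun i => rightOp (dz i)) j (rightOp (dxi j)))).prod *
      (List.ofFn fun i => rightOp (dzBar i)).prod).unop (Pi.single 0 1) =
      (-(-1) ^ (j : ℕ) : ℂ) • Pi.single (exchangedMonomial j) (1 : ℂ) := by
  have hm : IsMonomial (exchangedMonomial j) :=
    IsMonomial.of_add_left (b := mixedMonomial j)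
      (exchangedMonomial_add_mixedMonomial j ▸ topMonomial_isMonomial)
  have hu : Function.update (fun i => rightOp (dz i)) j (rightOp (dxi j)) =
      fun i => rightOp (Function.update dz j (dxi j) i) := by
    funext i
    by_cases h : i = j
    · subst h
      simp
    · simp [h]
  rw [hu]
  change (List.ofFn fun i => rightOp (dzBar i)).prod.unop
    ((List.ofFn fun i => rightOp (Function.update dz j (dxi j) i)).prod.unop (Pi.single 0 1)) = _
  rw [prod_rightOp_single _ _ (by rw [zero_add]; exact hm.of_add_left), zero_add, map_smul,
    unop_prod_rightOp_dzBar _ hm, mulSign_zero_left, smul_smul, ← exchangedMonomial]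
  congr 1
  have e1 : ∀ i, i ≠ j → (Function.update dz j (dxi j) i : Gen n) = dz i := fun i hi =>
    Function.update_of_ne hi _ _
  have e2 : (∏ i, ∏ k, if i < k then mulSign (Pi.single (Function.update dz j (dxi j) i) 1)
      (Pi.single (Function.update dz j (dxi j) k) 1) else 1 : ℤ) = (-1) ^ (n - 1 - j : ℕ) := by
    rw [Finset.prod_eq_single j]
    · rw [Function.update_self]
      have : ∀ k, (if j < k then mulSign (Pi.single (dxi j) 1)
          (Pi.single (Function.update dz j (dxi j) k) 1) else 1 : ℤ) =
          if j < k then -1 else 1 := fun k => by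
        split_ifs with h
        · rw [e1 k h.ne', mulSign_dxi_dz]
        · rfl
      simp only [this, Finset.prod_ite, Finset.prod_const, one_pow, mul_one]
      rw [Finset.filter_lt_eq_Ioi, Fin.card_Ioi]
    · intro i _ hi
      refine Finset.prod_eq_one fun k _ => ?_
      split_ifs with h
      · rw [e1 i hi]
        by_cases hk : k = j
        · subst hk
          rw [Function.update_self]
          exact mulSign_single_of_lt (dz_lt_dxi _ _)
        · rw [e1 k hk]
          exact mulSign_single_of_lt (dz_lt_dz h)
      · rfl
    · simp
  have e3 : mulSign (∑ i, Pi.single (Function.update dz j (dxi j) i) 1)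
      (∑ i, Pi.single (dzBar i) 1 : Gen n → ℕ) = (-1) ^ n := by
    rw [mulSign_sum_left, Finset.prod_eq_single j]
    · rw [Function.update_self, mulSign_sum_right]
      simp [mulSign_single_of_gt (dzBar_lt_dxi _ _), commSign_dxi_dzBar]
    · intro i _ hi
      rw [e1 i hi, mulSign_sum_right]
      exact Finset.prod_eq_one fun k _ => mulSign_single_of_lt (dz_lt_dzBar _ _)
    · simp
  rw [e2, e3]
  push_cast
  rw [one_mul, ← pow_add]
  have hj := j.2
  have : n - 1 - (j : ℕ) + n + 2 * j = j + 1 + 2 * (n - 1) := by omega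
  have h2 : ∀ m : ℕ, ((-1 : ℂ)) ^ (2 * m) = 1 := fun m => by rw [pow_mul]; simp
  calc (-1 : ℂ) ^ (n - 1 - (j : ℕ) + n) = (-1) ^ (n - 1 - (j : ℕ) + n + 2 * j) := by
        rw [pow_add _ _ (2 * (j : ℕ)), h2, mul_one]
    _ = -(-1) ^ (j : ℕ) := by rw [this, pow_add, h2, pow_succ]; ring

theorem quadraticOp_pow_unop_apply (M : Matrix (Fin n) (Fin n) ℂ) (c : Gen n → ℕ) :
    (quadraticOp M ^ n).unop (Pi.single 0 1) c =
      ((n.factorial : ℂ) * (-1) ^ (n * (n - 1) / 2) * M.det) *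
        ((if c = bodyMonomial then 1 else 0) +
          ∑ j : Fin n, -(-1) ^ (j : ℕ) * if c = exchangedMonomial j then 1 else 0) := by
  rw [quadraticOp_pow, add_mul, Finset.sum_mul]
  simp only [MulOpposite.unop_smul, MulOpposite.unop_add, Finset.unop_sum, LinearMap.smul_apply,
    LinearMap.add_apply, LinearMap.sum_apply, unop_prod_rightOp_body,
    unop_prod_rightOp_exchanged, Pi.smul_apply, Pi.add_apply, Finset.sum_apply, smul_eq_mul,
    Pi.single_apply]

end Words
-- The coefficients of the localizing form.
section Localizer

variable {n : ℕ}

theorem coeff_add {M : Type} [AddCommGroup M] [Module ℂ M] (Φ Ψ : Superform n M)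
    (a : Gen n → ℕ) : coeff (Φ + Ψ) a = coeff Φ a + coeff Ψ a := by
  unfold coeff
  split_ifs <;> simp

theorem coeff_neg {M : Type} [AddCommGroup M] [Module ℂ M] (Φ : Superform n M)
    (a : Gen n → ℕ) : coeff (-Φ) a = -coeff Φ a := by
  unfold coeff
  split_ifs <;> simp

theorem coeff_sub {M : Type} [AddCommGroup M] [Module ℂ M] (Φ Ψ : Superform n M)
    (a : Gen n → ℕ) : coeff (Φ - Ψ) a = coeff Φ a - coeff Ψ a := by
  unfold coeff
  split_ifs <;> simp

theorem coeff_smul {M : Type} [AddCommGroup M] [Module ℂ M] (r : ℂ) (Φ : Superform n M)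
    (a : Gen n → ℕ) : coeff (r • Φ) a = r • coeff Φ a := by
  unfold coeff
  split_ifs <;> simp

theorem coeff_sum {M : Type} [AddCommGroup M] [Module ℂ M] {ι : Type*} (s : Finset ι)
    (Φ : ι → Superform n M) (a : Gen n → ℕ) :
    coeff (∑ i ∈ s, Φ i) a = ∑ i ∈ s, coeff (Φ i) a := by
  unfold coeff
  split_ifs <;> simp

theorem isMonomial_single (k : Gen n) : IsMonomial (Pi.single k 1) :=
  isMonomial_of_le_one fun l => by
    by_cases h : l = k
    · subst h
      simp
    · simp [h]

theorem coeff_ofGen (k : Gen n) (a : Gen n → ℕ) (z : Fin n → ℂ) :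
    coeff (ofGen k) a z = if a = Pi.single k 1 then 1 else 0 := by
  by_cases h : IsMonomial a
  · rw [coeff_of_isMonomial _ h]
    simp only [ofGen]
  · rw [coeff_of_not_isMonomial _ h, if_neg]
    · rfl
    · rintro rfl
      exact h (isMonomial_single k)

theorem coeff_wedge_ofFun_left (f : (Fin n → ℂ) → ℂ) (Ψ : Superform n ℂ) (c : Gen n → ℕ)
    (z : Fin n → ℂ) : coeff (wedge (ofFun f) Ψ) c z = f z * coeff Ψ c z := by
  by_cases h : IsMonomial c
  · rw [coeff_wedge _ _ h, Finset.sum_eq_single 0]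
    · simp [coeff_ofFun, mulSign_zero_left, mul_comm]
    · intro a _ ha
      simp [coeff_ofFun, ha]
    · simp
  · simp [coeff_of_not_isMonomial _ h]

theorem coeff_wedge_ofFun_right (Φ : Superform n ℂ) (f : (Fin n → ℂ) → ℂ) (c : Gen n → ℕ)
    (z : Fin n → ℂ) : coeff (wedge Φ (ofFun f)) c z = f z * coeff Φ c z := by
  by_cases h : IsMonomial c
  · rw [coeff_wedge _ _ h, Finset.sum_eq_single c]
    · simp [coeff_ofFun, mulSign_zero_right]
    · intro a ha hne
      rw [coeff_ofFun, if_neg]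
      · simp
      · rw [tsub_eq_zero_iff_le]
        exact fun hca => hne (le_antisymm (Finset.mem_Iic.1 ha) hca)
    · simp
  · simp [coeff_of_not_isMonomial _ h]

theorem coeff_omega (g : Fin n → (Fin n → ℂ) → ℂ) (a : Gen n → ℕ) (z : Fin n → ℂ) :
    coeff (omega g) a z = ∑ j, starRingEnd ℂ (g j z) *
      ((if a = Pi.single (dz j) 1 then 1 else 0) + if a = Pi.single (dxi j) 1 then 1 else 0) := by
  simp only [omega, coeff_add, coeff_sum, Pi.add_apply, Finset.sum_apply,
    coeff_wedge_ofFun_right, coeff_ofGen, mul_add, Finset.sum_add_distrib]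

theorem coeff_leftDeriv (k : Gen n) (Φ : Superform n ℂ) {c : Gen n → ℕ} (h : IsMonomial c)
    (z : Fin n → ℂ) : coeff (leftDeriv k Φ) c z =
      (∏ l, if l < k then (commSign k l : ℂ) ^ c l else 1) * (c k + 1 : ℂ) *
        coeff Φ (c + Pi.single k 1) z := by
  rw [coeff_of_isMonomial _ h, leftDeriv]

theorem add_single_eq_single_iff {c : Gen n → ℕ} {k l : Gen n} :
    c + Pi.single k 1 = Pi.single l 1 ↔ c = 0 ∧ k = l := by
  constructor
  · intro h
    have hkl : k = l := by
      by_contra hkl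
      have := congrFun h k
      simp [hkl] at this
    subst hkl
    exact ⟨by simpa using h, rfl⟩
  · rintro ⟨rfl, rfl⟩
    simp

theorem coeff_contract_omega (g : Fin n → (Fin n → ℂ) → ℂ) (c : Gen n → ℕ) (z : Fin n → ℂ) :
    coeff (contract g (omega g)) c z =
      if c = 0 then ∑ j, g j z * starRingEnd ℂ (g j z) else 0 := by
  simp only [contract, coeff_sum, Finset.sum_apply, coeff_wedge_ofFun_left]
  by_cases h : IsMonomial c
  · simp only [coeff_leftDeriv _ _ h, coeff_omega, add_single_eq_single_iff,
      (dz_ne_dxi _ _).symm, and_false, if_false, zero_add]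
    by_cases h0 : c = 0
    · subst h0
      simp [dxi]
    · simp [h0]
  · rw [if_neg (by rintro rfl; exact h fun k _ => by simp)]
    simp [coeff_of_not_isMonomial _ h]

theorem coeff_leftDeriv_xiBar_omega (g : Fin n → (Fin n → ℂ) → ℂ) (j : Fin n) (c : Gen n → ℕ) :
    coeff (leftDeriv (xiBar j) (omega g)) c = 0 := by
  funext z
  by_cases h : IsMonomial c
  · have h1 : ∀ i : Fin n, xiBar j ≠ dz i := fun i h => by
      simpa [xiBar, dz] using congrArg (fun k => (ofLex k).1) h
    have h2 : ∀ i : Fin n, xiBar j ≠ dxi i := fun i h => by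
      simpa [xiBar, dxi] using congrArg (fun k => (ofLex k).1) h
    simp [coeff_leftDeriv _ _ h, coeff_omega, add_single_eq_single_iff, h1, h2]
  · simp [coeff_of_not_isMonomial _ h]

/-- The conjugate of the Jacobian matrix. -/
noncomputable def conjJacobian (g : Fin n → (Fin n → ℂ) → ℂ) (z : Fin n → ℂ) :
    Matrix (Fin n) (Fin n) ℂ :=
  (jacobian g z).map (starRingEnd ℂ)

theorem wirtingerBar_conj_sum {g : Fin n → (Fin n → ℂ) → ℂ} {z : Fin n → ℂ}
    (hg : ∀ i, DifferentiableAt ℂ (g i) z) (c : Fin n → ℂ) (k : Fin n) :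
    wirtingerBar k (fun z => ∑ i, starRingEnd ℂ (g i z) * c i) z =
      ∑ i, conjJacobian g z i k * c i := by
  have hd : HasFDerivAt (𝕜 := ℝ) (fun z => ∑ i, starRingEnd ℂ (g i z) * c i)
      (∑ i, (c i) • (Complex.conjCLE.toContinuousLinearMap.comp
        ((fderiv ℂ (g i) z).restrictScalars ℝ))) z := by
    refine HasFDerivAt.fun_sum fun i _ => ?_
    have h := (Complex.conjCLE.toContinuousLinearMap.hasFDerivAt (x := g i z)).comp z
      ((hg i).hasFDerivAt.restrictScalars ℝ)
    exact h.mul_const (c i)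
  rw [wirtingerBar, hd.fderiv]
  simp only [sum_apply, smul_apply,
    ContinuousLinearMap.comp_apply, ContinuousLinearMap.coe_restrictScalars',
    Finset.mul_sum, ← Finset.sum_add_distrib, Finset.sum_div]
  refine Finset.sum_congr rfl fun i _ => ?_
  -- The derivative of `g i` is complex linear, so conjugation turns the factor `I` into `-I`. The
  -- two halves of the Wirtinger derivative then agree.
  have hI : (Pi.single k Complex.I : Fin n → ℂ) = Complex.I • Pi.single k 1 := by
    rw [← Pi.single_smul, smul_eq_mul, mul_one]
  rw [hI, map_smul]
  simp only [conjJacobian, jacobian, Matrix.map_apply, Matrix.of_apply, smul_eq_mul]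
  simp
  ring_nf
  simp
  ring

open Classical in
theorem coeff_wedge_ofGen_of_sum (k : Gen n) (l : Fin n → Gen n) (m : Fin n → ℂ)
    (Ψ : Superform n ℂ) (z : Fin n → ℂ) (c : Gen n → ℕ) (hc : IsMonomial c)
    (hΨ : ∀ d, IsMonomial d →
      coeff Ψ d z = ∑ i, m i * if d = Pi.single (l i) 1 then 1 else 0) :
    coeff (wedge (ofGen k) Ψ) c z = ∑ i, m i *
      ((mulSign (Pi.single k 1) (Pi.single (l i) 1) : ℂ) *
        if c = Pi.single k 1 + Pi.single (l i) 1 then 1 else 0) := by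
  rw [coeff_wedge _ _ hc]
  simp only [coeff_ofGen]
  by_cases h : c k = 0
  · rw [Finset.sum_eq_zero, Finset.sum_eq_zero]
    · intro i _
      rw [if_neg]
      · simp
      · rintro rfl
        simp at h
    · intro a ha
      rw [if_neg]
      · simp
      · rintro rfl
        have := Finset.mem_Iic.1 ha k
        simp [h] at this
  · obtain ⟨d, rfl⟩ := exists_eq_add_single h
    rw [add_comm d] at hc ⊢
    rw [Finset.sum_eq_single (Pi.single k 1)]
    · rw [if_pos rfl, add_tsub_cancel_left, hΨ d (hc.mono (le_add_self)), smul_eq_mul, mul_one,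
        zsmul_eq_mul, Finset.mul_sum]
      refine Finset.sum_congr rfl fun i _ => ?_
      by_cases hd : d = Pi.single (l i) 1
      · subst hd
        simp
        ring
      · simp [hd]
    · intro a _ ha
      simp [ha]
    · intro h
      exact absurd (Finset.mem_Iic.2 le_self_add) h

theorem coeff_dbar_omega {g : Fin n → (Fin n → ℂ) → ℂ} {z : Fin n → ℂ}
    (hg : ∀ i, DifferentiableAt ℂ (g i) z) {c : Gen n → ℕ} (hc : IsMonomial c) :
    coeff (dbar (omega g)) c z = -quadraticCoeff (conjJacobian g z) c := by
  classical
  have h2 : ∀ j : Fin n, coeff (wedge (ofGen (dxiBar j)) (leftDeriv (xiBar j) (omega g))) c z =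
      0 := fun j => by
    rw [coeff_wedge _ _ hc]
    simp [coeff_leftDeriv_xiBar_omega]
  have h1 : ∀ (k : Fin n) (d : Gen n → ℕ), IsMonomial d →
      coeff (fun a => wirtingerBar k (omega g a) : Superform n ℂ) d z =
        ∑ i, conjJacobian g z i k * ((if d = Pi.single (dz i) 1 then 1 else 0) +
          if d = Pi.single (dxi i) 1 then 1 else 0) := fun k d hd => by
    rw [coeff_of_isMonomial _ hd, ← wirtingerBar_conj_sum hg]
    congr 1
    funext w
    rw [← coeff_omega, coeff_of_isMonomial _ hd]
  simp only [dbar, coeff_add, coeff_sum, Pi.add_apply, Finset.sum_apply, h2,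
    Finset.sum_const_zero, add_zero]
  rw [quadraticCoeff, ← Finset.sum_neg_distrib]
  refine Finset.sum_congr rfl fun k _ => ?_
  set W : Superform n ℂ := fun a => wirtingerBar k (omega g a)
  -- The two parts of `ω` sort differently: `dz̄_k ∧ dz_i` has to be swapped, `dz̄_k ∧ dξ_i` is
  -- already increasing.
  let W1 : Superform n ℂ := fun a _ => ∑ i, conjJacobian g z i k *
    if a.1 = Pi.single (dz i) 1 then 1 else 0
  let W2 : Superform n ℂ := fun a _ => ∑ i, conjJacobian g z i k *
    if a.1 = Pi.single (dxi i) 1 then 1 else 0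
  have hW : ∀ d, IsMonomial d → coeff W d z = coeff W1 d z + coeff W2 d z := fun d hd => by
    rw [h1 k d hd, coeff_of_isMonomial W1 hd, coeff_of_isMonomial W2 hd, ← Finset.sum_add_distrib]
    simp only [mul_add]
  have hsplit : coeff (wedge (ofGen (dzBar k)) W) c z =
      coeff (wedge (ofGen (dzBar k)) W1) c z + coeff (wedge (ofGen (dzBar k)) W2) c z := by
    rw [coeff_wedge _ _ hc, coeff_wedge _ _ hc, coeff_wedge _ _ hc, ← Finset.sum_add_distrib]
    refine Finset.sum_congr rfl fun a _ => ?_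
    rw [hW _ (hc.mono tsub_le_self), add_smul, smul_add]
  rw [hsplit, coeff_wedge_ofGen_of_sum _ dz (fun i => conjJacobian g z i k) W1 z c hc
      fun d hd => congrFun (coeff_of_isMonomial W1 hd) z,
    coeff_wedge_ofGen_of_sum _ dxi (fun i => conjJacobian g z i k) W2 z c hc
      fun d hd => congrFun (coeff_of_isMonomial W2 hd) z,
    ← Finset.sum_add_distrib, ← Finset.sum_neg_distrib]
  refine Finset.sum_congr rfl fun i _ => ?_
  rw [mulSign_single_of_gt (dz_lt_dzBar _ _), mulSign_single_of_lt (dzBar_lt_dxi _ _),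
    commSign_comm, commSign_dz_dzBar, add_comm (Pi.single (dzBar k) 1) (Pi.single (dz i) 1)]
  push_cast
  ring

theorem coeff_wedge_affine (M : Matrix (Fin n) (Fin n) ℂ) (r s : ℂ) (Φ Ψ : Superform n ℂ)
    (z : Fin n → ℂ) (hΨ : ∀ b, IsMonomial b →
      coeff Ψ b z = r * quadraticCoeff M b + if b = 0 then s else 0) :
    (fun c => coeff (wedge Φ Ψ) c z) =
      (r • quadraticOp M).unop (fun c => coeff Φ c z) + s • fun c => coeff Φ c z := by
  classical
  let Q : Superform n ℂ := fun a _ => quadraticCoeff M a.1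
  have hQ := coeff_wedge_quadratic M Φ Q z fun b hb => congrFun (coeff_of_isMonomial Q hb) z
  rw [MulOpposite.unop_smul, LinearMap.smul_apply, ← hQ]
  funext c
  simp only [Pi.add_apply, Pi.smul_apply, smul_eq_mul]
  have hS := coeff_wedge_ofFun_right Φ (fun _ => s) c z
  rw [← hS]
  by_cases hc : IsMonomial c
  · rw [coeff_wedge _ _ hc, coeff_wedge _ _ hc, coeff_wedge _ _ hc, Finset.mul_sum,
      ← Finset.sum_add_distrib]
    refine Finset.sum_congr rfl fun a _ => ?_
    have hm : IsMonomial (c - a) := hc.mono tsub_le_self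
    rw [hΨ _ hm, coeff_of_isMonomial Q hm, coeff_ofFun]
    simp only [zsmul_eq_mul, smul_eq_mul, Q]
    ring
  · simp [coeff_of_not_isMonomial _ hc]

/-- `wedgePow` multiplies on the right at each step, so it iterates one operator on the coefficients
of the constant form `1`. -/
theorem coeff_wedgePow_affine (M : Matrix (Fin n) (Fin n) ℂ) (r s : ℂ) (Ψ : Superform n ℂ)
    (z : Fin n → ℂ) (hΨ : ∀ b, IsMonomial b →
      coeff Ψ b z = r * quadraticCoeff M b + if b = 0 then s else 0) (m : ℕ) :
    (fun c => coeff (wedgePow Ψ m) c z) = ((r • quadraticOp M + s • 1) ^ m).unop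
      (Pi.single 0 1) := by
  induction m with
  | zero =>
    funext c
    simp [wedgePow, coeff_ofFun, Pi.single_apply]
  | succ m ih =>
    rw [wedgePow, coeff_wedge_affine M r s _ _ z hΨ, ih, pow_succ]
    rfl

/-- The number of factors `dz̄_k` of a monomial. -/
def barDegree (c : Gen n → ℕ) : ℕ := ∑ k, c (dzBar k)

theorem barDegree_add_single (d : Gen n → ℕ) (k : Gen n) :
    barDegree (d + Pi.single k 1) = barDegree d + barDegree (Pi.single k 1) := by
  simp [barDegree, Finset.sum_add_distrib]

theorem barDegree_single_dzBar (k : Fin n) : barDegree (Pi.single (dzBar k) 1) = 1 := by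
  have h : ∀ i : Fin n, dzBar i = dzBar k ↔ i = k := fun i => by simp [dzBar]
  simp [barDegree, Pi.single_apply, h]

theorem barDegree_single_of_ne {l : Gen n} (h : (ofLex l).1 ≠ 1) :
    barDegree (Pi.single l 1) = 0 := by
  refine Finset.sum_eq_zero fun k _ => Pi.single_eq_of_ne ?_ _
  rintro rfl
  exact h rfl

theorem rightMul_apply_ne_zero {k : Gen n} {F : (Gen n → ℕ) → ℂ} {m : ℕ}
    (hF : ∀ c, F c ≠ 0 → barDegree c = m) {c : Gen n → ℕ} (h : rightMul k F c ≠ 0) :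
    barDegree c = m + barDegree (Pi.single k 1) := by
  by_cases hc : c k = 0
  · exact absurd (rightMul_apply_of_eq_zero F hc) h
  obtain ⟨d, rfl⟩ := exists_eq_add_single hc
  by_cases hm : IsMonomial (d + Pi.single k 1)
  · rw [rightMul_apply_add _ hm] at h
    rw [barDegree_add_single, hF d (right_ne_zero_of_mul h)]
  · exact absurd (rightMul_apply_of_not_isMonomial F hm) h

theorem quadraticOp_apply_ne_zero {M : Matrix (Fin n) (Fin n) ℂ} {F : (Gen n → ℕ) → ℂ} {m : ℕ}
    (hF : ∀ c, F c ≠ 0 → barDegree c = m) {c : Gen n → ℕ}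
    (h : (quadraticOp M).unop F c ≠ 0) : barDegree c = m + 1 := by
  contrapose! h
  simp only [quadraticOp, Finset.unop_sum, LinearMap.sum_apply, Finset.sum_apply]
  refine Finset.sum_eq_zero fun k _ => ?_
  rw [Finset.sum_mul]
  simp only [Finset.unop_sum, LinearMap.sum_apply, Finset.sum_apply]
  refine Finset.sum_eq_zero fun i _ => ?_
  rw [smul_mul_assoc, add_mul]
  simp only [MulOpposite.unop_smul, MulOpposite.unop_add, LinearMap.smul_apply,
    LinearMap.add_apply, Pi.smul_apply, Pi.add_apply]
  have h1 : ∀ l : Gen n, (ofLex l).1 ≠ 1 → (rightOp l * rightOp (dzBar k)).unop F c = 0 := by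
    intro l hl
    by_contra hne
    refine h ?_
    have := rightMul_apply_ne_zero (fun c hc => rightMul_apply_ne_zero hF hc) hne
    rwa [barDegree_single_dzBar, barDegree_single_of_ne hl, add_zero] at this
  rw [h1 _ (by simp [dz]), h1 _ (by simp [dxi]), add_zero, smul_zero]

/-- Each application of the quadratic operator adds exactly one `dz̄`. -/
theorem quadraticOp_pow_apply_ne_zero {M : Matrix (Fin n) (Fin n) ℂ} (m : ℕ) {c : Gen n → ℕ}
    (h : (quadraticOp M ^ m).unop (Pi.single 0 1) c ≠ 0) : barDegree c = m := by
  induction m generalizing c with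
  | zero =>
    have : c = 0 := by
      by_contra hc
      simp [hc] at h
    simp [this, barDegree]
  | succ m ih =>
    rw [pow_succ] at h
    exact quadraticOp_apply_ne_zero (fun c hc => ih hc) h

/-- By the grading, only the binomial term of exponent `barDegree c` contributes to the monomial
`c`. -/
theorem affine_pow_unop_apply (M : Matrix (Fin n) (Fin n) ℂ) (r s : ℂ) (m : ℕ)
    (c : Gen n → ℕ) :
    ((r • quadraticOp M + s • 1) ^ m).unop (Pi.single 0 1) c =
      (m.choose (barDegree c) : ℂ) * s ^ (m - barDegree c) * (r ^ barDegree c *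
        (quadraticOp M ^ barDegree c).unop (Pi.single 0 1) c) := by
  have hcomm : Commute (r • quadraticOp M) (s • 1) := (Commute.one_right _).smul_right s
  have hterm : ∀ i, ((r • quadraticOp M) ^ i * (s • 1) ^ (m - i) *
      (m.choose i : (Module.End ℂ ((Gen n → ℕ) → ℂ))ᵐᵒᵖ)) =
      ((m.choose i : ℂ) * s ^ (m - i) * r ^ i) • quadraticOp M ^ i := fun i => by
    rw [smul_pow, smul_pow, one_pow, mul_smul_comm, mul_one, ← nsmul_eq_mul',
      ← Nat.cast_smul_eq_nsmul ℂ, smul_smul, smul_smul, mul_assoc]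
  rw [hcomm.add_pow]
  simp only [hterm, Finset.unop_sum, MulOpposite.unop_smul, LinearMap.sum_apply,
    Finset.sum_apply, LinearMap.smul_apply, Pi.smul_apply, smul_eq_mul]
  rw [Finset.sum_eq_single (barDegree c)]
  · ring
  · intro i _ hi
    have : (quadraticOp M ^ i).unop (Pi.single 0 1) c = 0 := by
      by_contra h
      exact hi (quadraticOp_pow_apply_ne_zero i h).symm
    rw [this, mul_zero]
  -- If `barDegree c` exceeds `m`, the truncated exponent is harmless because the binomial
  -- coefficient is zero.
  · intro h
    rw [Nat.choose_eq_zero_of_lt (by simpa using h)]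
    simp

/-- As `C(m, k) / m! = 1 / (k! (m - k)!)`, this is the exponential series shifted by `k`; the first
`k` terms vanish. -/
theorem hasSum_choose_mul_pow (s q : ℂ) (k : ℕ) :
    HasSum (fun m : ℕ => ((m.factorial : ℂ))⁻¹ * ((m.choose k : ℂ) * s ^ (m - k) * q))
      (Complex.exp s * ((k.factorial : ℂ)⁻¹ * q)) := by
  rw [← hasSum_nat_add_iff' k, Finset.sum_eq_zero, sub_zero]
  · have h := (NormedSpace.expSeries_div_hasSum_exp s).mul_right ((k.factorial : ℂ)⁻¹ * q)
    rw [← Complex.exp_eq_exp_ℂ] at h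
    convert! h using 2 with m
    have h1 := Nat.add_choose_mul_factorial_mul_factorial m k
    have h2 : ((m + k).choose k : ℂ) * m.factorial * k.factorial = (m + k).factorial := by
      exact_mod_cast h1
    rw [Nat.add_sub_cancel, ← h2]
    have hk : (k.factorial : ℂ) ≠ 0 := Nat.cast_ne_zero.2 k.factorial_ne_zero
    have hm : (m.factorial : ℂ) ≠ 0 := Nat.cast_ne_zero.2 m.factorial_ne_zero
    have hc : ((m + k).choose k : ℂ) ≠ 0 :=
      Nat.cast_ne_zero.2 (Nat.choose_pos (Nat.le_add_left _ _)).ne'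
    field_simp
  · intro i hi
    rw [Nat.choose_eq_zero_of_lt (Finset.mem_range.1 hi)]
    simp

/-- The squared norm of the vector field. -/
noncomputable def normSqField (g : Fin n → (Fin n → ℂ) → ℂ) (z : Fin n → ℂ) : ℝ :=
  ∑ j, ‖g j z‖ ^ 2

/-- The coefficients of `exp(-∂̄ω)` at a point. -/
noncomputable def expCoeff (g : Fin n → (Fin n → ℂ) → ℂ) (c : Gen n → ℕ) (z : Fin n → ℂ) : ℂ :=
  ((barDegree c).factorial : ℂ)⁻¹ *
    (quadraticOp (conjJacobian g z) ^ barDegree c).unop (Pi.single 0 1) c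

theorem coeff_localizer {g : Fin n → (Fin n → ℂ) → ℂ} {z : Fin n → ℂ}
    (hg : ∀ i, DifferentiableAt ℂ (g i) z) {c : Gen n → ℕ} (hc : IsMonomial c) (t : ℝ) :
    coeff (localizer g t) c z = (t : ℂ)⁻¹ ^ barDegree c *
      (Complex.exp (-(normSqField g z / t : ℝ)) * expCoeff g c z) := by
  rw [coeff_of_isMonomial _ hc, localizer, expForm]
  set Ψ : Superform n ℂ := -((t : ℂ)⁻¹ • dbar (omega g)) - (t : ℂ)⁻¹ • contract g (omega g)
    with hΨdef
  have hnorm : (∑ j, g j z * starRingEnd ℂ (g j z)) = (normSqField g z : ℂ) := by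
    rw [normSqField]
    push_cast
    exact Finset.sum_congr rfl fun j _ => Complex.mul_conj' _
  have hΨ : ∀ b, IsMonomial b → coeff Ψ b z = (t : ℂ)⁻¹ * quadraticCoeff (conjJacobian g z) b +
      if b = 0 then (-(normSqField g z / t : ℝ) : ℂ) else 0 := fun b hb => by
    rw [hΨdef]
    simp only [coeff_sub, coeff_neg, coeff_smul, Pi.sub_apply, Pi.neg_apply, Pi.smul_apply,
      coeff_dbar_omega hg hb, coeff_contract_omega, hnorm, smul_eq_mul]
    split_ifs
    · push_cast
      ring
    · ring
  have hpow := fun m => congrFun (coeff_wedgePow_affine _ _ _ Ψ z hΨ m) c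
  simp only [affine_pow_unop_apply, coeff_of_isMonomial _ hc] at hpow
  simp only [hpow]
  rw [(hasSum_choose_mul_pow _ _ _).tsum_eq, expCoeff]
  ring

end Localizer
-- Gaussian integrals and Laplace's method.
section Analysis

variable {n : ℕ}

/-- The squared Euclidean norm on `ℂ^n`. -/
noncomputable def sqNorm (w : Fin n → ℂ) : ℝ := ∑ j, ‖w j‖ ^ 2

theorem continuous_sqNorm : Continuous (sqNorm : (Fin n → ℂ) → ℝ) := by
  unfold sqNorm
  fun_prop

theorem sqNorm_smul (s : ℝ) (w : Fin n → ℂ) : sqNorm (s • w) = s ^ 2 * sqNorm w := by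
  simp [sqNorm, mul_pow, Finset.mul_sum]

theorem sqNorm_le (w : Fin n → ℂ) : sqNorm w ≤ n * ‖w‖ ^ 2 := by
  calc sqNorm w ≤ ∑ _j : Fin n, ‖w‖ ^ 2 := Finset.sum_le_sum fun j _ => by
        gcongr
        exact norm_le_pi_norm w j
    _ = n * ‖w‖ ^ 2 := by simp

theorem norm_sq_le_sqNorm (w : Fin n → ℂ) : ‖w‖ ^ 2 ≤ sqNorm w := by
  have h0 : 0 ≤ sqNorm w := Finset.sum_nonneg fun j _ => by positivity
  rw [← Real.le_sqrt (norm_nonneg w) h0, pi_norm_le_iff_of_nonneg (Real.sqrt_nonneg _)]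
  intro j
  rw [Real.le_sqrt (norm_nonneg _) h0]
  exact Finset.single_le_sum (f := fun j => ‖w j‖ ^ 2) (fun j _ => by positivity)
    (Finset.mem_univ j)

theorem isOpen_bodyBall (p : Fin n → ℂ) (ε : ℝ) : IsOpen (bodyBall p ε) :=
  isOpen_lt (by fun_prop) continuous_const

theorem bodyBall_subset (p : Fin n → ℂ) (ε : ℝ) : bodyBall p ε ⊆ closedBodyBall p ε :=
  fun _ hz => le_of_lt (Set.mem_ofPred.1 hz)

theorem mem_bodyBall_self (p : Fin n → ℂ) {ε : ℝ} (hε : 0 < ε) : p ∈ bodyBall p ε := by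
  simp [bodyBall]
  positivity

theorem isCompact_closedBodyBall (p : Fin n → ℂ) (ε : ℝ) : IsCompact (closedBodyBall p ε) := by
  refine Metric.isCompact_of_isClosed_isBounded (isClosed_le (by fun_prop) continuous_const) ?_
  refine (Metric.isBounded_closedBall (x := p) (r := |ε|)).subset fun z hz => ?_
  rw [mem_closedBall_iff_norm]
  refine abs_le_of_sq_le_sq' ?_ (abs_nonneg _) |>.2
  rw [sq_abs]
  exact (norm_sq_le_sqNorm (z - p)).trans hz

/-- The Cauchy estimate on a small circle in the complex line through `z` in direction `v` bounds
the difference of derivatives by the difference of values, which is uniformly small on the circle by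
compactness. -/
theorem continuousOn_partialDeriv {U : Set (Fin n → ℂ)} (hU : IsOpen U) {f : (Fin n → ℂ) → ℂ}
    (hf : DifferentiableOn ℂ f U) (v : Fin n → ℂ) :
    ContinuousOn (fun z => fderiv ℂ f z v) U := by
  intro z₀ hz₀
  refine ContinuousAt.continuousWithinAt ?_
  obtain ⟨ρ, hρ, hρU⟩ := Metric.isOpen_iff.1 hU z₀ hz₀
  -- The `+ 1` covers `v = 0`. Base points within `ρ / 2` then keep the whole disc of radius `r`
  -- inside `U`.
  set r := ρ / (2 * (‖v‖ + 1)) with hr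
  have hr0 : 0 < r := by positivity
  have hrv : r * ‖v‖ < ρ / 2 := by
    rw [hr, div_mul_eq_mul_div, div_lt_div_iff₀ (by positivity) (by positivity)]
    nlinarith [norm_nonneg v]
  have hmem : ∀ z ∈ Metric.ball z₀ (ρ / 2), ∀ ζ : ℂ, ‖ζ‖ ≤ r → z + ζ • v ∈ U := by
    intro z hz ζ hζ
    apply hρU
    rw [mem_ball_iff_norm] at hz ⊢
    have h1 : ‖ζ • v‖ ≤ r * ‖v‖ := by
      rw [norm_smul]
      gcongr
    calc ‖z + ζ • v - z₀‖ = ‖(z - z₀) + ζ • v‖ := by congr 1; abel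
      _ ≤ ‖z - z₀‖ + ‖ζ • v‖ := norm_add_le _ _
      _ < ρ := by linarith
  have hball : ∀ᶠ z in 𝓝 z₀, z ∈ Metric.ball z₀ (ρ / 2) := Metric.ball_mem_nhds _ (by positivity)
  have hz₀ball : z₀ ∈ Metric.ball z₀ (ρ / 2) := Metric.mem_ball_self (by positivity)
  have hdiff : ∀ z ∈ Metric.ball z₀ (ρ / 2), ∀ ζ : ℂ, ‖ζ‖ ≤ r →
      HasDerivAt (fun ζ : ℂ => f (z + ζ • v)) (fderiv ℂ f (z + ζ • v) v) ζ := by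
    intro z hz ζ hζ
    have h1 : HasDerivAt (fun ζ : ℂ => z + ζ • v) v ζ := by
      simpa using ((hasDerivAt_id ζ).smul_const v).const_add z
    exact ((hf.differentiableAt (hU.mem_nhds (hmem z hz ζ hζ))).hasFDerivAt).comp_hasDerivAt ζ h1
  rw [Metric.continuousAt_iff']
  intro δ hδ
  have hunif : ∀ᶠ z in 𝓝 z₀, ∀ ζ ∈ Metric.sphere (0 : ℂ) r,
      ‖f (z + ζ • v) - f (z₀ + ζ • v)‖ < δ * r / 2 := by
    refine (isCompact_sphere (0 : ℂ) r).eventually_forall_of_forall_eventually fun ζ hζ => ?_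
    have hfc : ContinuousAt f (z₀ + ζ • v) :=
      (hf.differentiableAt (hU.mem_nhds (hmem z₀ hz₀ball ζ
        (by simpa using (mem_sphere_iff_norm.1 hζ).le)))).continuousAt
    have h1 : ContinuousAt (fun y : (Fin n → ℂ) × ℂ => f (y.1 + y.2 • v)) (z₀, ζ) :=
      ContinuousAt.comp (f := fun y : (Fin n → ℂ) × ℂ => y.1 + y.2 • v) hfc (by fun_prop)
    have h2 : ContinuousAt (fun y : (Fin n → ℂ) × ℂ => f (z₀ + y.2 • v)) (z₀, ζ) :=
      ContinuousAt.comp (f := fun y : (Fin n → ℂ) × ℂ => z₀ + y.2 • v) hfc (by fun_prop)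
    have h3 := (h1.sub h2).norm
    have h4 : ‖f ((z₀, ζ).1 + (z₀, ζ).2 • v) - f (z₀ + (z₀, ζ).2 • v)‖ < δ * r / 2 := by
      simp only [sub_self, norm_zero]
      positivity
    exact h3.eventually (gt_mem_nhds h4)
  filter_upwards [hball, hunif] with z hz hzu
  have hd : ∀ ζ : ℂ, ‖ζ‖ ≤ r → HasDerivAt (fun ζ : ℂ => f (z + ζ • v) - f (z₀ + ζ • v))
      (fderiv ℂ f (z + ζ • v) v - fderiv ℂ f (z₀ + ζ • v) v) ζ := fun ζ hζ =>
    (hdiff z hz ζ hζ).sub (hdiff z₀ hz₀ball ζ hζ)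
  have hcl : DiffContOnCl ℂ (fun ζ : ℂ => f (z + ζ • v) - f (z₀ + ζ • v)) (Metric.ball 0 r) := by
    refine DifferentiableOn.diffContOnCl fun ζ hζ => ?_
    rw [closure_ball _ hr0.ne', mem_closedBall_zero_iff] at hζ
    exact (hd ζ hζ).differentiableAt.differentiableWithinAt
  have hle := Complex.norm_deriv_le_of_forall_mem_sphere_norm_le hr0 hcl fun ζ hζ => (hzu ζ hζ).le
  rw [(hd 0 (by simpa using hr0.le)).deriv] at hle
  simp only [zero_smul, add_zero] at hle
  rw [dist_eq_norm]
  calc _ ≤ δ * r / 2 / r := hle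
    _ = δ / 2 := by field_simp
    _ < δ := by linarith

theorem integral_exp_neg_sqNorm :
    ∫ w : Fin n → ℂ, Real.exp (-sqNorm w) = Real.pi ^ n := by
  have h1 : ∫ w : ℂ, Real.exp (-‖w‖ ^ 2) = Real.pi := by
    have := GaussianFourier.integral_rexp_neg_mul_sq_norm (V := ℂ) one_pos
    simpa using this
  have h2 : ∀ w : Fin n → ℂ, Real.exp (-sqNorm w) = ∏ j, Real.exp (-‖w j‖ ^ 2) := fun w => by
    rw [← Real.exp_sum, sqNorm, Finset.sum_neg_distrib]
  simp only [h2]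
  rw [integral_fintype_prod_volume_eq_pow (fun w : ℂ => Real.exp (-‖w‖ ^ 2)), h1,
    Fintype.card_fin]

theorem integrable_exp_neg_mul_sqNorm {c : ℝ} (hc : 0 < c) :
    Integrable fun w : Fin n → ℂ => Real.exp (-(c * sqNorm w)) := by
  have h1 : Integrable fun w : ℂ => Real.exp (-c * ‖w‖ ^ 2) := by
    -- The integral of a non-integrable function is `0` by convention, so a nonzero value proves
    -- integrability.
    refine Integrable.of_integral_ne_zero ?_
    rw [GaussianFourier.integral_rexp_neg_mul_sq_norm hc]
    positivity
  have h2 : ∀ w : Fin n → ℂ, Real.exp (-(c * sqNorm w)) = ∏ j, Real.exp (-c * ‖w j‖ ^ 2) :=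
    fun w => by
      rw [← Real.exp_sum, sqNorm, ← Finset.mul_sum, neg_mul]
  simp only [h2]
  exact Integrable.fintype_prod fun _ => h1

/-- The real determinant of a complex linear map is the squared modulus of its complex determinant.
-/
theorem integral_exp_neg_sqNorm_mulVec {J : Matrix (Fin n) (Fin n) ℂ} (hJ : J.det ≠ 0) :
    ∫ w : Fin n → ℂ, Real.exp (-sqNorm (J.mulVec w)) = Real.pi ^ n / Complex.normSq J.det := by
  let A : (Fin n → ℂ) →ₗ[ℝ] (Fin n → ℂ) := (Matrix.toLin' J).restrictScalars ℝ
  have hA : LinearMap.det A = Complex.normSq J.det := by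
    rw [LinearMap.det_restrictScalars, LinearMap.det_toLin', Algebra.norm_complex_apply]
  have hpos : 0 < Complex.normSq J.det := Complex.normSq_pos.2 hJ
  have hA0 : LinearMap.det A ≠ 0 := by rw [hA]; exact hpos.ne'
  have hmap := Measure.map_linearMap_addHaar_eq_smul_addHaar
    (volume : Measure (Fin n → ℂ)) hA0
  have hcont : Continuous A := A.continuous_of_finiteDimensional
  have h := integral_map (μ := (volume : Measure (Fin n → ℂ))) hcont.aemeasurable
    (f := fun w => Real.exp (-sqNorm w))
    (Real.continuous_exp.comp continuous_sqNorm.neg).aestronglyMeasurable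
  rw [hmap, integral_smul_measure, integral_exp_neg_sqNorm, hA] at h
  change ∫ w, Real.exp (-sqNorm (A w)) = _
  rw [← h, ENNReal.toReal_ofReal (abs_nonneg _), abs_of_pos (inv_pos.2 hpos), smul_eq_mul]
  field_simp

/-- Laplace's method on `ℂ^n`. -/
theorem tendsto_laplace {B : Set (Fin n → ℂ)} (hB : IsOpen B) {p : Fin n → ℂ} (hp : p ∈ B)
    {h : (Fin n → ℂ) → ℝ} (hh : ContinuousOn h B) {φ : (Fin n → ℂ) → ℂ}
    (hφ : ContinuousOn φ B) {C c : ℝ} (hC : ∀ z ∈ B, ‖φ z‖ ≤ C) (hc : 0 < c)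
    (hlow : ∀ z ∈ B, c * sqNorm (z - p) ≤ h z) {A : (Fin n → ℂ) → (Fin n → ℂ)}
    (hA : ∀ w, Tendsto (fun s : ℝ => h (p + s • w) / s ^ 2) (𝓝[>] 0) (𝓝 (sqNorm (A w)))) :
    Tendsto (fun t : ℝ => (t : ℂ)⁻¹ ^ n * ∫ z in B, Complex.exp (-(h z / t : ℝ)) * φ z) (𝓝[>] 0)
      (𝓝 ((∫ w, Real.exp (-sqNorm (A w)) : ℝ) * φ p)) := by
  -- This is the integrand after the substitution `z = p + s w` with `s = √t`, extended by zero off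
  -- `B`.
  let F : ℝ → (Fin n → ℂ) → ℂ := fun s w =>
    B.indicator (fun z => Complex.exp (-(h z / s ^ 2 : ℝ)) * φ z) (p + s • w)
  have hC0 : 0 ≤ C := (norm_nonneg _).trans (hC p hp)
  have hlim : Tendsto (fun s => ∫ w, F s w) (𝓝[>] 0)
      (𝓝 (∫ w, (Real.exp (-sqNorm (A w)) : ℂ) * φ p)) := by
    -- The quadratic lower bound on `h` gives a Gaussian majorant independent of `s`.
    refine tendsto_integral_filter_of_dominated_convergence
      (fun w => C * Real.exp (-(c * sqNorm w))) ?_ ?_ ?_ ?_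
    · filter_upwards with s
      have hmap : Continuous fun w : Fin n → ℂ => p + s • w := by fun_prop
      have hB' : IsOpen ((fun w : Fin n → ℂ => p + s • w) ⁻¹' B) := hB.preimage hmap
      have : F s = ((fun w : Fin n → ℂ => p + s • w) ⁻¹' B).indicator
          ((fun z => Complex.exp (-(h z / s ^ 2 : ℝ)) * φ z) ∘ fun w => p + s • w) := by
        rfl
      rw [this, aestronglyMeasurable_indicator_iff hB'.measurableSet]
      refine ContinuousOn.aestronglyMeasurable ?_ hB'.measurableSet
      refine ContinuousOn.comp (t := B) ?_ hmap.continuousOn fun w hw => hw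
      refine ContinuousOn.mul ?_ hφ
      exact Complex.continuous_exp.comp_continuousOn
        (Complex.continuous_ofReal.comp_continuousOn (hh.div_const _)).neg
    · filter_upwards [self_mem_nhdsWithin] with s hs
      filter_upwards with w
      have hs0 : 0 < s := hs
      by_cases hw : p + s • w ∈ B
      · simp only [F, Set.indicator_of_mem hw, norm_mul, Complex.norm_exp]
        rw [mul_comm]
        refine mul_le_mul (hC _ hw) ?_ (Real.exp_pos _).le hC0
        rw [← Complex.ofReal_neg, Complex.ofReal_re, Real.exp_le_exp, neg_le_neg_iff,
          le_div_iff₀ (by positivity)]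
        have := hlow _ hw
        rw [add_sub_cancel_left, sqNorm_smul] at this
        linarith
      · simp only [F, Set.indicator_of_notMem hw, norm_zero]
        positivity
    · exact (integrable_exp_neg_mul_sqNorm hc).const_mul C
    · filter_upwards with w
      have hline : Tendsto (fun s : ℝ => p + s • w) (𝓝[>] 0) (𝓝 p) := by
        have : Continuous fun s : ℝ => p + s • w := by fun_prop
        have h := (this.tendsto 0).mono_left (nhdsWithin_le_nhds (s := Set.Ioi 0))
        simpa using h
      have hmem : ∀ᶠ s : ℝ in 𝓝[>] 0, p + s • w ∈ B := hline.eventually (hB.mem_nhds hp)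
      have h1 : Tendsto (fun s : ℝ => Complex.exp (-(h (p + s • w) / s ^ 2 : ℝ)) * φ (p + s • w))
          (𝓝[>] 0) (𝓝 ((Real.exp (-sqNorm (A w)) : ℂ) * φ p)) := by
        refine Tendsto.mul ?_ ((hφ.continuousAt (hB.mem_nhds hp)).tendsto.comp hline)
        rw [Complex.ofReal_exp, Complex.ofReal_neg]
        exact (Complex.continuous_exp.tendsto _).comp
          ((Complex.continuous_ofReal.tendsto _).comp (hA w)).neg
      refine h1.congr' ?_
      filter_upwards [hmem] with s hs
      simp only [F, Set.indicator_of_mem hs]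
  have hsqrt : Tendsto (fun t : ℝ => √t) (𝓝[>] 0) (𝓝[>] 0) := by
    refine tendsto_nhdsWithin_iff.2 ⟨?_, ?_⟩
    · have := (Real.continuous_sqrt.tendsto 0).mono_left (nhdsWithin_le_nhds (s := Set.Ioi 0))
      simpa using this
    · filter_upwards [self_mem_nhdsWithin] with t ht
      exact Real.sqrt_pos.2 ht
  have hfin := hlim.comp hsqrt
  rw [integral_mul_const, integral_complex_ofReal] at hfin
  refine hfin.congr' ?_
  filter_upwards [self_mem_nhdsWithin] with t ht
  have ht0 : (0 : ℝ) < t := ht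
  have hsq : √t ^ 2 = t := Real.sq_sqrt ht0.le
  simp only [Function.comp_apply, F]
  rw [Measure.integral_comp_smul_of_nonneg (volume : Measure (Fin n → ℂ))
    (fun w => B.indicator (fun z => Complex.exp (-(h z / √t ^ 2 : ℝ)) * φ z) (p + w)) √t
    (hR := Real.sqrt_nonneg t),
    integral_add_left_eq_self (B.indicator fun z => Complex.exp (-(h z / √t ^ 2 : ℝ)) * φ z) p,
    integral_indicator hB.measurableSet, hsq]
  -- The real dimension is `2n`, so scaling by `√t` contributes exactly `t^n`.
  have hrank : Module.finrank ℝ (Fin n → ℂ) = 2 * n := by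
    rw [Module.finrank_pi_fintype]
    simp [Complex.finrank_real_complex, mul_comm]
  rw [hrank, pow_mul, hsq, Complex.real_smul]
  push_cast
  rw [inv_pow]

theorem fderiv_eq_jacobian_mulVec (g : Fin n → (Fin n → ℂ) → ℂ) (p w : Fin n → ℂ) (i : Fin n) :
    fderiv ℂ (g i) p w = (jacobian g p).mulVec w i := by
  conv_lhs => rw [← Finset.univ_sum_single w, map_sum]
  simp only [Matrix.mulVec, dotProduct, jacobian, Matrix.of_apply]
  refine Finset.sum_congr rfl fun j _ => ?_
  have : (Pi.single j (w j) : Fin n → ℂ) = w j • Pi.single j 1 := by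
    rw [← Pi.single_smul, smul_eq_mul, mul_one]
  rw [this, map_smul, smul_eq_mul, mul_comm]

/-- A nondegenerate zero of a vector field, its only zero in a compact set. -/
theorem exists_mul_sqNorm_le_normSqField {g : Fin n → (Fin n → ℂ) → ℂ} {K : Set (Fin n → ℂ)}
    (hK : IsCompact K) {p : Fin n → ℂ} (hg : ∀ i, ContinuousOn (g i) K)
    (hd : ∀ i, DifferentiableAt ℂ (g i) p) (hp : ∀ i, g i p = 0)
    (hdet : (jacobian g p).det ≠ 0) (hiso : ∀ z ∈ K, (∀ i, g i z = 0) → z = p) :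
    ∃ c > 0, ∀ z ∈ K, c * sqNorm (z - p) ≤ normSqField g z := by
  let G : (Fin n → ℂ) → (Fin n → ℂ) := fun z i => g i z
  have hGle : ∀ z, ‖G z‖ ^ 2 ≤ normSqField g z := fun z => norm_sq_le_sqNorm (G z)
  have hGp : G p = 0 := funext hp
  let A : (Fin n → ℂ) →L[ℂ] (Fin n → ℂ) := ContinuousLinearMap.pi fun i => fderiv ℂ (g i) p
  have hGd : HasFDerivAt G A p := hasFDerivAt_pi.2 fun i => (hd i).hasFDerivAt
  have hAker : LinearMap.ker (A : (Fin n → ℂ) →ₗ[ℂ] (Fin n → ℂ)) = ⊥ := by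
    refine LinearMap.ker_eq_bot'.2 fun w hw => ?_
    refine Matrix.eq_zero_of_mulVec_eq_zero hdet (funext fun i => ?_)
    rw [← fderiv_eq_jacobian_mulVec]
    exact congrFun hw i
  have hAind : IsInducing A := (LinearMap.isClosedEmbedding_of_injective hAker).isInducing
  -- The derivative is injective in finite dimension, hence an embedding, so `z - p = O(G z)` near
  -- `p`.
  obtain ⟨C₁, hC₁⟩ := (hGd.isTheta_sub hAind).isBigO_symm.bound
  obtain ⟨V, hVC, hVo, hpV⟩ := eventually_nhds_iff.1 hC₁
  have hne : ∀ z ∈ K \ V, ‖G z‖ ≠ 0 := by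
    rintro z ⟨hzK, hzV⟩ h0
    have := hiso z hzK fun i => congrFun (norm_eq_zero.1 h0) i
    exact hzV (this ▸ hpV)
  have hGc : ContinuousOn G K := continuousOn_pi.2 hg
  -- Away from `p` the field has no zero on a compact set, so the quotient is continuous and
  -- bounded.
  obtain ⟨C₂, hC₂⟩ := (hK.diff hVo).exists_bound_of_continuousOn
    (f := fun z => ‖z - p‖ / ‖G z‖)
    (((continuous_id.sub continuous_const).norm.continuousOn).div
      (hGc.mono Set.sdiff_subset).norm hne)
  set C := max (max C₁ C₂) 1 with hCdef
  have hC0 : 0 < C := lt_max_of_lt_right one_pos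
  have hbound : ∀ z ∈ K, ‖z - p‖ ≤ C * ‖G z‖ := by
    intro z hz
    by_cases hzV : z ∈ V
    · have := hVC z hzV
      rw [hGp, sub_zero] at this
      refine this.trans ?_
      gcongr
      exact (le_max_left _ _).trans (le_max_left _ _)
    · have h1 := hC₂ z ⟨hz, hzV⟩
      have hpos : 0 < ‖G z‖ := lt_of_le_of_ne (norm_nonneg _) (hne z ⟨hz, hzV⟩).symm
      rw [Real.norm_of_nonneg (by positivity), div_le_iff₀ hpos] at h1
      refine h1.trans ?_
      gcongr
      exact (le_max_right _ _).trans (le_max_left _ _)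
  -- The factor compares the sup norm with the Euclidean one; `n + 1` instead of `n` keeps the
  -- constant positive when `n = 0`.
  refine ⟨((n + 1) * C ^ 2)⁻¹, by positivity, fun z hz => ?_⟩
  rw [inv_mul_le_iff₀ (by positivity)]
  calc sqNorm (z - p) ≤ n * ‖z - p‖ ^ 2 := sqNorm_le _
    _ ≤ (n + 1) * (C * ‖G z‖) ^ 2 := by
        gcongr
        · linarith
        · exact hbound z hz
    _ = (n + 1) * C ^ 2 * ‖G z‖ ^ 2 := by ring
    _ ≤ (n + 1) * C ^ 2 * normSqField g z := by
        gcongr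
        exact hGle z

theorem tendsto_normSqField_div {g : Fin n → (Fin n → ℂ) → ℂ} {p : Fin n → ℂ}
    (hd : ∀ i, DifferentiableAt ℂ (g i) p) (hp : ∀ i, g i p = 0) (w : Fin n → ℂ) :
    Tendsto (fun s : ℝ => normSqField g (p + s • w) / s ^ 2) (𝓝[>] 0)
      (𝓝 (sqNorm ((jacobian g p).mulVec w))) := by
  have h1 : ∀ i, Tendsto (fun s : ℝ => s⁻¹ • g i (p + s • w)) (𝓝[>] 0)
      (𝓝 ((jacobian g p).mulVec w i)) := fun i => by
    have h := ((hd i).hasFDerivAt.restrictScalars ℝ).hasLineDerivAt w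
    have h2 := (hasDerivAt_iff_tendsto_slope.1 h).mono_left
      (nhdsWithin_mono (0 : ℝ) (fun x hx => ne_of_gt hx : Set.Ioi (0 : ℝ) ⊆ {0}ᶜ))
    rw [← fderiv_eq_jacobian_mulVec]
    refine h2.congr fun s => ?_
    simp [slope_def_module, hp]
  have h3 := tendsto_finsetSum Finset.univ fun i _ => ((h1 i).norm.pow 2)
  refine h3.congr fun s => ?_
  simp only [normSqField, norm_smul, mul_pow, ← Finset.mul_sum, norm_inv, Real.norm_eq_abs,
    inv_pow, sq_abs]
  rw [div_eq_inv_mul]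

end Analysis
-- Selecting the terms that survive the limit.
section Residue

variable {n : ℕ}

theorem continuousOn_rightMul {U : Set (Fin n → ℂ)} {F : (Fin n → ℂ) → (Gen n → ℕ) → ℂ}
    (hF : ∀ c, ContinuousOn (fun z => F z c) U) (k : Gen n) (c : Gen n → ℕ) :
    ContinuousOn (fun z => rightMul k (F z) c) U := by
  by_cases hc : c k = 0
  · simp only [rightMul_apply_of_eq_zero _ hc]
    exact continuousOn_const
  obtain ⟨d, rfl⟩ := exists_eq_add_single hc
  by_cases hm : IsMonomial (d + Pi.single k 1)
  · simp only [rightMul_apply_add _ hm]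
    exact continuousOn_const.mul (hF d)
  · simp only [rightMul_apply_of_not_isMonomial _ hm]
    exact continuousOn_const

theorem continuousOn_quadraticOp {U : Set (Fin n → ℂ)} {F : (Fin n → ℂ) → (Gen n → ℕ) → ℂ}
    (hF : ∀ c, ContinuousOn (fun z => F z c) U) {M : (Fin n → ℂ) → Matrix (Fin n) (Fin n) ℂ}
    (hM : ∀ i k, ContinuousOn (fun z => M z i k) U) (c : Gen n → ℕ) :
    ContinuousOn (fun z => (quadraticOp (M z)).unop (F z) c) U := by
  have h : ∀ z, (quadraticOp (M z)).unop (F z) c = ∑ k, ∑ i, M z i k *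
      (rightMul (dzBar k) (rightMul (dz i) (F z)) c +
        rightMul (dzBar k) (rightMul (dxi i) (F z)) c) := fun z => by
    simp only [quadraticOp, Finset.sum_mul, smul_mul_assoc, add_mul, Finset.unop_sum,
      MulOpposite.unop_smul, MulOpposite.unop_add, LinearMap.sum_apply, Finset.sum_apply,
      LinearMap.smul_apply, LinearMap.add_apply, Pi.smul_apply, Pi.add_apply, smul_eq_mul]
    rfl
  simp only [h]
  refine continuousOn_finsetSum _ fun k _ => continuousOn_finsetSum _ fun i _ =>
    (hM i k).mul (ContinuousOn.add ?_ ?_)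
  · exact continuousOn_rightMul (continuousOn_rightMul hF _) _ c
  · exact continuousOn_rightMul (continuousOn_rightMul hF _) _ c

/-- Laplace's method needs continuous amplitudes; these coefficients are polynomial in the conjugate
first derivatives of `g`. -/
theorem continuousOn_expCoeff {U : Set (Fin n → ℂ)} (hU : IsOpen U)
    {g : Fin n → (Fin n → ℂ) → ℂ} (hg : ∀ i, DifferentiableOn ℂ (g i) U) (c : Gen n → ℕ) :
    ContinuousOn (expCoeff g c) U := by
  have hM : ∀ i k, ContinuousOn (fun z => conjJacobian g z i k) U := fun i k =>
    Complex.continuous_conj.comp_continuousOn (continuousOn_partialDeriv hU (hg i) _)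
  have key : ∀ (m : ℕ) (c : Gen n → ℕ), ContinuousOn
      (fun z => (quadraticOp (conjJacobian g z) ^ m).unop (Pi.single 0 1) c) U := by
    intro m
    induction m with
    | zero => exact fun c => continuousOn_const
    | succ m ih =>
      intro c
      simp only [pow_succ]
      exact continuousOn_quadraticOp ih hM c
  exact continuousOn_const.mul (key _ c)

theorem barDegree_le {c : Gen n → ℕ} (h : ∀ k, c k ≤ 1) : barDegree c ≤ n := by
  calc barDegree c ≤ ∑ _k : Fin n, 1 := Finset.sum_le_sum fun k _ => h _
    _ = n := by simp

/-- With fewer than `n` factors `t⁻¹` the remaining factor `t^(n-k)` forces the limit to be zero. -/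
theorem tendsto_inv_pow_mul {k : ℕ} (hk : k ≤ n) {I : ℝ → ℂ} {L : ℂ}
    (h : Tendsto (fun t : ℝ => (t : ℂ)⁻¹ ^ n * I t) (𝓝[>] 0) (𝓝 L)) :
    Tendsto (fun t : ℝ => (t : ℂ)⁻¹ ^ k * I t) (𝓝[>] 0) (𝓝 (if k = n then L else 0)) := by
  split_ifs with hkn
  · rwa [hkn]
  have hpow : Tendsto (fun t : ℝ => (t : ℂ) ^ (n - k)) (𝓝[>] 0) (𝓝 0) := by
    have hc : Continuous fun t : ℝ => (t : ℂ) ^ (n - k) := by fun_prop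
    have := (hc.tendsto 0).mono_left (nhdsWithin_le_nhds (s := Set.Ioi 0))
    simpa [Nat.sub_ne_zero_of_lt (lt_of_le_of_ne hk hkn)] using this
  have := hpow.mul h
  rw [zero_mul] at this
  refine this.congr' ?_
  filter_upwards [self_mem_nhdsWithin] with t ht
  have ht0 : (t : ℂ) ≠ 0 := Complex.ofReal_ne_zero.2 (ne_of_gt ht)
  have hn : n = (n - k) + k := by omega
  conv_lhs => rw [hn]
  simp only [Nat.add_sub_cancel]
  rw [pow_add, ← mul_assoc, ← mul_assoc, ← mul_pow, mul_inv_cancel₀ ht0, one_pow, one_mul]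

theorem ite_barDegree_mul_expCoeff (g : Fin n → (Fin n → ℂ) → ℂ) (c : Gen n → ℕ)
    (z : Fin n → ℂ) : (if barDegree c = n then expCoeff g c z else 0) =
      ((-1) ^ (n * (n - 1) / 2) * starRingEnd ℂ (jacobian g z).det) *
        ((if c = bodyMonomial then 1 else 0) +
          ∑ j : Fin n, -(-1) ^ (j : ℕ) * if c = exchangedMonomial j then 1 else 0) := by
  have hdet : (conjJacobian g z).det = starRingEnd ℂ (jacobian g z).det :=
    ((starRingEnd ℂ).map_det _).symm
  have h : (if barDegree c = n then expCoeff g c z else 0) = (n.factorial : ℂ)⁻¹ *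
      (quadraticOp (conjJacobian g z) ^ n).unop (Pi.single 0 1) c := by
    split_ifs with hc
    · rw [expCoeff, hc]
    · have : (quadraticOp (conjJacobian g z) ^ n).unop (Pi.single 0 1) c = 0 := by
        by_contra hne
        exact hc (quadraticOp_pow_apply_ne_zero n hne)
      rw [this, mul_zero]
  rw [h, quadraticOp_pow_unop_apply, hdet]
  have hn : (n.factorial : ℂ) ≠ 0 := Nat.cast_ne_zero.2 n.factorial_ne_zero
  field_simp

theorem sum_mulSign_mul_ite {a b : Gen n → ℕ} (hab : b + a = topMonomial)
    (f : (Gen n → ℕ) → ℂ) :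
    ∑ c ∈ Finset.Iic (topMonomial : Gen n → ℕ), (mulSign c (topMonomial - c) : ℂ) *
      ((if topMonomial - c = b then 1 else 0) * f c) = (mulSign a b : ℂ) * f a := by
  have hb : topMonomial - a = b := by rw [← hab, add_tsub_cancel_right]
  rw [Finset.sum_eq_single a]
  · rw [hb, if_pos rfl, one_mul]
  · intro c hc hne
    rw [if_neg]
    · simp
    · rintro h
      have h1 := tsub_add_cancel_of_le (Finset.mem_Iic.1 hc)
      rw [h, ← hab] at h1
      exact hne (add_left_cancel h1)
  · intro h
    exact absurd (Finset.mem_Iic.2 (hab ▸ le_add_self)) h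

/-- The sign `-(-1)^j` occurs twice, once from sorting the exchanged product and once from
multiplying it with the mixed monomial, so every coefficient of `η` enters with sign `+`. -/
theorem sum_mulSign_mul_expCoeff (g : Fin n → (Fin n → ℂ) → ℂ) (z : Fin n → ℂ)
    (f : (Gen n → ℕ) → ℂ) :
    ∑ c ∈ Finset.Iic (topMonomial : Gen n → ℕ), (mulSign c (topMonomial - c) : ℂ) *
      ((if barDegree (topMonomial - c) = n then expCoeff g (topMonomial - c) z else 0) * f c) =
      ((-1) ^ (n * (n - 1) / 2) * starRingEnd ℂ (jacobian g z).det) *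
        (f fermiMonomial + ∑ j, f (mixedMonomial j)) := by
  set κ := (-1) ^ (n * (n - 1) / 2) * starRingEnd ℂ (jacobian g z).det with hκ
  have h1 := sum_mulSign_mul_ite bodyMonomial_add_fermiMonomial f
  have h2 := fun j => sum_mulSign_mul_ite (exchangedMonomial_add_mixedMonomial j) f
  have hsq : ∀ j : Fin n, (-(-1) ^ (j : ℕ) : ℂ) * (-(-1) ^ (j : ℕ)) = 1 := fun j => by
    rw [neg_mul_neg, ← pow_add, ← two_mul, pow_mul]
    simp
  rw [mulSign_fermiMonomial_bodyMonomial, Int.cast_one, one_mul] at h1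
  have h3 : ∀ j, f (mixedMonomial j) = (-(-1) ^ (j : ℕ) : ℂ) *
      ∑ c ∈ Finset.Iic (topMonomial : Gen n → ℕ), (mulSign c (topMonomial - c) : ℂ) *
        ((if topMonomial - c = exchangedMonomial j then 1 else 0) * f c) := fun j => by
    rw [h2, mulSign_mixedMonomial_exchangedMonomial]
    push_cast
    rw [← mul_assoc, hsq, one_mul]
  rw [← h1]
  simp only [h3, Finset.mul_sum]
  rw [Finset.sum_comm, ← Finset.sum_add_distrib, Finset.mul_sum]
  refine Finset.sum_congr rfl fun c _ => ?_
  rw [ite_barDegree_mul_expCoeff, ← hκ, ← sub_eq_zero]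
  simp only [mul_add, add_mul, Finset.mul_sum, Finset.sum_mul]
  rw [sub_eq_zero]
  congr 1
  · ring
  · exact Finset.sum_congr rfl fun j _ => by ring

theorem coeff_wedge_localizer {g : Fin n → (Fin n → ℂ) → ℂ} {z : Fin n → ℂ}
    (hg : ∀ i, DifferentiableAt ℂ (g i) z) (η : Superform n GrassmannC) (t : ℝ)
    (l : Finset ℕ) :
    coeff (wedge η (localizer g t)) topMonomial z l =
      ∑ c ∈ Finset.Iic (topMonomial : Gen n → ℕ), (t : ℂ)⁻¹ ^ barDegree (topMonomial - c) *
        (Complex.exp (-(normSqField g z / t : ℝ)) * ((mulSign c (topMonomial - c) : ℂ) *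
          (expCoeff g (topMonomial - c) z * coeff η c z l))) := by
  rw [coeff_wedge _ _ topMonomial_isMonomial, Finset.sum_apply]
  refine Finset.sum_congr rfl fun c _ => ?_
  rw [Pi.smul_apply, Pi.smul_apply,
    coeff_localizer hg (topMonomial_isMonomial.mono tsub_le_self), zsmul_eq_mul, smul_eq_mul]
  ring

end Residue
end SuperResidue

/-! ### The residue formula. -/

open SuperResidue in
theorem mainTheorem5 (n : ℕ) (U : Set (Fin n → ℂ)) (hU : IsOpen U)
    (g : Fin n → (Fin n → ℂ) → ℂ) (hg : ∀ i, DifferentiableOn ℂ (g i) U)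
    (p : Fin n → ℂ) (hp : ∀ i, g i p = 0) (hdet : (SuperResidue.jacobian g p).det ≠ 0)
    (ε : ℝ) (hε : 0 < ε) (hball : SuperResidue.closedBodyBall p ε ⊆ U)
    (hiso : ∀ z ∈ SuperResidue.closedBodyBall p ε, (∀ i, g i z = 0) → z = p)
    (η : SuperResidue.Superform n SuperResidue.GrassmannC) (hη : SuperResidue.SmoothOn η U) :
    SuperResidue.HasResidue g η p ε
      ((2 * (Real.pi : ℂ) / Complex.I) ^ n •
        ((SuperResidue.jacobian g p).det⁻¹ •
          (SuperResidue.coeff η SuperResidue.fermiMonomial p +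
            ∑ j, SuperResidue.coeff η (SuperResidue.mixedMonomial j) p))) := by
  have hK := isCompact_closedBodyBall p ε
  have hBK := bodyBall_subset p ε
  have hBo := isOpen_bodyBall p ε
  have hpB := mem_bodyBall_self p hε
  have hdiff : ∀ z ∈ U, ∀ i, DifferentiableAt ℂ (g i) z := fun z hz i =>
    (hg i).differentiableAt (hU.mem_nhds hz)
  have hnorm : ContinuousOn (normSqField g) U :=
    continuousOn_finsetSum _ fun j _ => ((hg j).continuousOn.norm.pow 2)
  -- The index `l` is a coordinate of the Grassmann constants and `c` a monomial of `η`, paired with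
  -- its complement in the localizing form.
  let φ : Finset ℕ → (Gen n → ℕ) → (Fin n → ℂ) → ℂ := fun l c z =>
    (mulSign c (topMonomial - c) : ℂ) * (expCoeff g (topMonomial - c) z * coeff η c z l)
  have hφ : ∀ l c, ContinuousOn (φ l c) U := fun l c => by
    refine continuousOn_const.mul ((continuousOn_expCoeff hU hg _).mul ?_)
    by_cases hc : IsMonomial c
    · simp only [coeff_of_isMonomial _ hc]
      exact (hη ⟨c, hc⟩ l).continuousOn
    · simp only [coeff_of_not_isMonomial _ hc]
      exact continuousOn_const
  have hint : ∀ (t : ℝ) l c, IntegrableOn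
      (fun z => Complex.exp (-(normSqField g z / t : ℝ)) * φ l c z) (bodyBall p ε) := by
    intro t l c
    refine IntegrableOn.mono_set (ContinuousOn.integrableOn_compact hK ?_) hBK
    refine ContinuousOn.mono (ContinuousOn.mul ?_ (hφ l c)) hball
    exact Complex.continuous_exp.comp_continuousOn
      (Complex.continuous_ofReal.comp_continuousOn (hnorm.div_const _)).neg
  have hexp : ∀ (t : ℝ) l, Set.EqOn (fun z => coeff (wedge η (localizer g t)) topMonomial z l)
      (fun z => ∑ c ∈ Finset.Iic (topMonomial : Gen n → ℕ),
        (t : ℂ)⁻¹ ^ barDegree (topMonomial - c) *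
          (Complex.exp (-(normSqField g z / t : ℝ)) * φ l c z)) (bodyBall p ε) :=
    fun t l z hz => coeff_wedge_localizer (hdiff z (hball (hBK hz))) η t l
  refine ⟨fun t _ l => ?_, ?_⟩
  · refine IntegrableOn.congr_fun ?_ (hexp t l).symm hBo.measurableSet
    exact integrable_finsetSum _ fun c _ => (hint t l c).const_mul _
  obtain ⟨c₀, hc₀, hlow⟩ := exists_mul_sqNorm_le_normSqField hK
    (fun i => (hg i).continuousOn.mono hball) (hdiff p (hball (hBK hpB))) hp hdet hiso
  refine tendsto_pi_nhds.2 fun l => ?_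
  have hsum : ∀ t : ℝ, superIntegral (bodyBall p ε) (wedge η (localizer g t)) l =
      (-1) ^ (n * (n - 1) / 2) * (-2 * Complex.I) ^ n *
        ∑ c ∈ Finset.Iic (topMonomial : Gen n → ℕ), (t : ℂ)⁻¹ ^ barDegree (topMonomial - c) *
          ∫ z in bodyBall p ε, Complex.exp (-(normSqField g z / t : ℝ)) * φ l c z := fun t => by
    rw [superIntegral, setIntegral_congr_fun hBo.measurableSet (hexp t l),
      integral_finsetSum _ fun c _ => (hint t l c).const_mul _]
    simp only [integral_const_mul]
  simp only [hsum]
  have hlim : ∀ c : Gen n → ℕ, Tendsto (fun t : ℝ => (t : ℂ)⁻¹ ^ barDegree (topMonomial - c) *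
      ∫ z in bodyBall p ε, Complex.exp (-(normSqField g z / t : ℝ)) * φ l c z) (𝓝[>] 0)
      (𝓝 (if barDegree (topMonomial - c) = n then
        ((Real.pi ^ n / Complex.normSq (jacobian g p).det : ℝ) : ℂ) * φ l c p else 0)) := by
    intro c
    refine tendsto_inv_pow_mul (barDegree_le fun k => ?_) ?_
    -- Complements in the top monomial have exponents at most `1`, hence at most `n` factors `dz̄`.
    · exact Nat.sub_le 1 (c k)
    obtain ⟨C, hC⟩ := hK.exists_bound_of_continuousOn ((hφ l c).mono hball)
    rw [← integral_exp_neg_sqNorm_mulVec hdet]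
    exact tendsto_laplace hBo hpB (hnorm.mono (hBK.trans hball))
      ((hφ l c).mono (hBK.trans hball)) (fun z hz => hC z (hBK hz)) hc₀
      (fun z hz => hlow z (hBK hz)) (tendsto_normSqField_div (hdiff p (hball (hBK hpB))) hp)
  have htot := (tendsto_finsetSum (Finset.Iic (topMonomial : Gen n → ℕ))
    fun c _ => hlim c).const_mul ((-1 : ℂ) ^ (n * (n - 1) / 2) * (-2 * Complex.I) ^ n)
  convert! htot using 2
  have hval : ∀ c : Gen n → ℕ, (if barDegree (topMonomial - c) = n then
      ((Real.pi ^ n / Complex.normSq (jacobian g p).det : ℝ) : ℂ) * φ l c p else 0) =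
      ((Real.pi ^ n / Complex.normSq (jacobian g p).det : ℝ) : ℂ) *
        ((mulSign c (topMonomial - c) : ℂ) * ((if barDegree (topMonomial - c) = n then
          expCoeff g (topMonomial - c) p else 0) * coeff η c p l)) := fun c => by
    split_ifs <;> simp [φ]
  simp only [hval, ← Finset.mul_sum]
  rw [sum_mulSign_mul_expCoeff g p fun c => coeff η c p l]
  simp only [Pi.smul_apply, Pi.add_apply, Finset.sum_apply, smul_eq_mul]
  set d := (jacobian g p).det
  have hconj : starRingEnd ℂ d ≠ 0 := (map_ne_zero _).2 hdet
  have hI : (2 * (Real.pi : ℂ) / Complex.I) ^ n = (-2 * Complex.I) ^ n * (Real.pi : ℂ) ^ n := by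
    rw [← mul_pow, Complex.div_I]
    ring
  have hs : ((-1 : ℂ) ^ (n * (n - 1) / 2)) * (-1) ^ (n * (n - 1) / 2) = 1 := by
    rw [← pow_add, ← two_mul, pow_mul]
    simp
  -- Writing `|d|² = conj d * d` lets the factor `conj d` from `Q^n` cancel, leaving `d⁻¹`; the two
  -- orientation signs cancel by `hs`.
  rw [hI, Complex.ofReal_div, Complex.normSq_eq_conj_mul_self]
  push_cast
  field_simp
  linear_combination
    -(coeff η fermiMonomial p l + ∑ j, coeff η (mixedMonomial j) p l) * hs
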